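/- Let $N\in\mathbb N$, $p>1$, $\gamma\in[0,1]$, $s\in(0,1]$ with $1/p<s<N/p$, and, if $\gamma>0$, also $p<N$. Let $\alpha>-sp$, $\beta>p(1-s)$, and put $$p^*_{\gamma,s,\alpha}=\frac{p(N+\alpha)}{N-sp}\ \text{ if }\gamma=0,\qquad p^*_{\gamma,s,\alpha}=\frac{p(N+\alpha)}{N-p}\ \text{ if }\gamma\in(0,1].$$ Write $\Phi_m(t)=|t|^{m-2}t$ for $m>1$ and $t$ a number or a vector, with $\Phi_m(0)=0$. For $\sigma\in(0,1]$ let $W^{\sigma,p}_{\mathrm{rad},\beta}(\mathbb R^N)$ be the space of radial measurable functions $u:\mathbb R^N\to\mathbb R$ with $\int_{\mathbb R^N}|x|^\beta|u|^p\,dx<\infty$ and $[u]_{\sigma,p}<\infty$, where $$[u]_{\sigma,p}^p=\iint_{\mathbb R^N\times\mathbb R^N}\frac{|u(x)-u(y)|^p}{|x-y|^{N+\sigma p}}\,dx\,dy\ \text{ if }\sigma<1,\qquad [u]_{1,p}^p=\int_{\mathbb R^N}|\nabla u|^p\,dx$$ with $\nabla u$ the weak gradient. Let $\mathcal W=W^{s,p}_{\mathrm{rad},\beta}(\mathbb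 R^N)$ if $\gamma=0$ and $\mathcal W=W^{1,p}_{\mathrm{rad},\beta}(\mathbb R^N)$ if $\gamma\in(0,1]$. A weak solution of $$\gamma(-\Delta_p)u+(1-\gamma)(-\Delta_p)^su+|x|^\beta|u|^{p-2}u=|x|^\alpha|u|^{q-2}u\quad\text{in }\mathbb R^N$$ is a function $u\in\mathcal W$ such that for every $v\in\mathcal W$ the following integrals converge absolutely (those with coefficient $0$ being omitted) and $$\gamma\int_{\mathbb R^N}\Phi_p(\nabla u)\cdot\nabla v\,dx+(1-\gamma)\iint_{\mathbb R^N\times\mathbb R^N}\frac{\Phi_p(u(x)-u(y))(v(x)-v(y))}{|x-y|^{N+sp}}\,dx\,dy+\int_{\mathbb R^N}|x|^\beta\Phi_p(u)v\,dx=\int_{\mathbb R^N}|x|^\alpha\Phi_q(u)v\,dx,$$ where for $s=1$ the double integral is replaced by $\int_{\mathbb R^N}\Phi_p(\nabla u)\cdot\nabla v\,dx$. Then for every $q>p^*_{\gamma,s,\alpha}$ the only weak solution $u\in\mathcal W\cap L^\infty(\mathbb R^N)$ that has a (locally integrable) weak gradient with $|\nabla u(x)|\,|x|\in L^r(\mathbb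 R^N)$ for some $r\in(1,\infty]$ is $u=0$ a.e. In particular, there is no such solution with $u>0$. -/

import Mathlib

open MeasureTheory
open scoped ENNReal ContDiff

noncomputable section

namespace MixedHenon

/-- The Euclidean space `ℝ^N`. -/
abbrev E (N : ℕ) : Type := EuclideanSpace ℝ (Fin N)

/-- `G` is a weak (distributional) gradient of `u` on `ℝ^N`. -/
def IsWeakGradient {N : ℕ} (u : E N → ℝ) (G : E N → E N) : Prop :=
  LocallyIntegrable u volume ∧ LocallyIntegrable G volume ∧
    ∀ φ : E N → ℝ, ContDiff ℝ ∞ φ → HasCompactSupport φ → ∀ e : E N,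
      ∫ x, u x * fderiv ℝ φ x e = -∫ x, φ x * inner ℝ (G x) e

/-- `u` has a weak gradient that is a locally integrable function. -/
def HasWeakGradient {N : ℕ} (u : E N → ℝ) : Prop := ∃ G : E N → E N, IsWeakGradient u G

open Classical in
/-- The weak gradient `∇u` (unique up to null sets); the junk value `0` is only taken
when no weak gradient exists. -/
def weakGrad {N : ℕ} (u : E N → ℝ) : E N → E N :=
  if h : HasWeakGradient u then h.choose else 0

/-- `Φ_p(t) = |t|^{p-2} t`, for numbers. -/
def Phi (p t : ℝ) : ℝ := |t| ^ (p - 2) * t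

/-- `Φ_p(ξ) = |ξ|^{p-2} ξ`, for vectors. -/
def PhiVec {N : ℕ} (p : ℝ) (ξ : E N) : E N := ‖ξ‖ ^ (p - 2) • ξ

/-- `u ∈ L^p_β(ℝ^N)`: `u` is measurable and `∫ |x|^β |u|^p dx < ∞`. -/
def MemWeightedLp {N : ℕ} (p β : ℝ) (u : E N → ℝ) : Prop :=
  AEStronglyMeasurable u volume ∧ Integrable (fun x : E N => ‖x‖ ^ β * |u x| ^ p) volume

/-- `[u]_{s,p} < ∞`, where `[u]_{s,p}` is the Gagliardo seminorm for `s < 1`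
and the `L^p` norm of the weak gradient for `s = 1`. -/
def FiniteSeminorm {N : ℕ} (s p : ℝ) (u : E N → ℝ) : Prop :=
  if s = 1 then HasWeakGradient u ∧ MemLp (weakGrad u) (ENNReal.ofReal p) volume
  else Integrable (fun z : E N × E N => |u z.1 - u z.2| ^ p / ‖z.1 - z.2‖ ^ ((N : ℝ) + s * p))
    (volume.prod volume)

/-- The weighted fractional Sobolev space `W^{s,p}_β(ℝ^N)`. -/
def MemW {N : ℕ} (s p β : ℝ) (u : E N → ℝ) : Prop :=
  MemWeightedLp p β u ∧ FiniteSeminorm s p u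

/-- `u` is radial, i.e. (as a class of functions modulo null sets) a function of `|x|`. -/
def IsRadial {N : ℕ} (u : E N → ℝ) : Prop :=
  ∃ g : ℝ → ℝ, u =ᵐ[volume] fun x => g ‖x‖

/-- The space `𝒲^{s,p}_β(ℝ^N)` of the variational framework: the radial functions of
`W^{s,p}_β(ℝ^N)` if `γ = 0`, and those of `W^{1,p}_β(ℝ^N)` otherwise. -/
def MemCalW {N : ℕ} (γ s p β : ℝ) (u : E N → ℝ) : Prop :=
  MemW (if γ = 0 then s else 1) p β u ∧ IsRadial u

/-- The integrand of `⟨-Δ_p u, v⟩`. -/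
def localIntegrand {N : ℕ} (p : ℝ) (u v : E N → ℝ) (x : E N) : ℝ :=
  inner ℝ (PhiVec p (weakGrad u x)) (weakGrad v x)

/-- The integrand of `⟨(-Δ_p)^s u, v⟩` for `s < 1`. -/
def nonlocalIntegrand {N : ℕ} (s p : ℝ) (u v : E N → ℝ) (z : E N × E N) : ℝ :=
  Phi p (u z.1 - u z.2) * (v z.1 - v z.2) / ‖z.1 - z.2‖ ^ ((N : ℝ) + s * p)

/-- The pairing `⟨(-Δ_p)^s u, v⟩` for `s ∈ (0,1]`, with `(-Δ_p)^1 = -Δ_p`. -/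
def fracPairing {N : ℕ} (s p : ℝ) (u v : E N → ℝ) : ℝ :=
  if s = 1 then ∫ x, localIntegrand p u v x
  else ∫ z, nonlocalIntegrand s p u v z ∂(volume.prod volume)

/-- The integral in `fracPairing` converges absolutely. -/
def FracPairingConverges {N : ℕ} (s p : ℝ) (u v : E N → ℝ) : Prop :=
  if s = 1 then Integrable (localIntegrand p u v) volume
  else Integrable (nonlocalIntegrand s p u v) (volume.prod volume)

/-- The pairing `⟨ℒ_{s,p,γ} u, v⟩`, where `ℒ_{s,p,γ} = γ (-Δ_p) + (1 - γ) (-Δ_p)^s`. -/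
def opPairing {N : ℕ} (γ s p : ℝ) (u v : E N → ℝ) : ℝ :=
  γ * (∫ x, localIntegrand p u v x) + (1 - γ) * fracPairing s p u v

/-- The integrals that occur in `opPairing` with a nonzero coefficient converge absolutely. -/
def OpPairingConverges {N : ℕ} (γ s p : ℝ) (u v : E N → ℝ) : Prop :=
  (γ ≠ 0 → Integrable (localIntegrand p u v) volume) ∧
    (γ ≠ 1 → FracPairingConverges s p u v)

/-- `u` is a weak solution of
`ℒ_{s,p,γ} u + |x|^β |u|^{p-2} u = |x|^α |u|^{q-2} u` in `ℝ^N`: `u ∈ 𝒲^{s,p}_β(ℝ^N)` and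
for every `v ∈ 𝒲^{s,p}_β(ℝ^N)` the integrals of the weak formulation exist and satisfy it.
No sign is imposed on `u`. -/
def IsWeakSolution {N : ℕ} (γ s p q α β : ℝ) (u : E N → ℝ) : Prop :=
  MemCalW γ s p β u ∧ ∀ v : E N → ℝ, MemCalW γ s p β v →
    OpPairingConverges γ s p u v ∧
    Integrable (fun x : E N => ‖x‖ ^ β * Phi p (u x) * v x) volume ∧
    Integrable (fun x : E N => ‖x‖ ^ α * Phi q (u x) * v x) volume ∧
    opPairing γ s p u v + ∫ x : E N, ‖x‖ ^ β * Phi p (u x) * v x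
      = ∫ x : E N, ‖x‖ ^ α * Phi q (u x) * v x

/-- The class of all `u ∈ 𝒲^{s,p}_β(ℝ^N) ∩ L^∞(ℝ^N)` such that
`|∇u(x)| |x| ∈ L^r(ℝ^N)` for some `r > 1`. -/
def MemX {N : ℕ} (γ s p β : ℝ) (u : E N → ℝ) : Prop :=
  MemCalW γ s p β u ∧ MemLp u ∞ volume ∧ HasWeakGradient u ∧
    ∃ r : ℝ≥0∞, 1 < r ∧ MemLp (fun x : E N => ‖weakGrad u x‖ * ‖x‖) r volume

/-- The critical exponent `p*_{γ,s,α}`. -/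
def critExp (N : ℕ) (γ s p α : ℝ) : ℝ :=
  if γ = 0 then p * ((N : ℝ) + α) / ((N : ℝ) - s * p) else p * ((N : ℝ) + α) / ((N : ℝ) - p)

end MixedHenon

end

/-! The theorem rests on a Pohozaev inequality, obtained without any regularity theory by testing
the equation with a deformed copy of the solution. Let `X_n` be the field x ↦ x cut off near the
origin and near infinity, let `φ_t(x) = x - t X_n(x)`, and let `u_t = u ∘ φ_t⁻¹` (`transport`). For
small t > 0 the map `φ_t` is a radial bi-Lipschitz diffeomorphism, so `u_t` again lies in the
solution space and is an admissible test function (`memCalW_transport`). Subtracting the weak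
formulations with test functions `u_t` and `u` gives an identity in which every term is a pairing of
`u` with `u_t - u`.

On the left-hand side, convexity bounds each pairing by `(E(u_t) - E(u)) / p`, where E is the
Dirichlet, Gagliardo or weighted energy. A change of variables computes E(u_t): where `X_n(x) = x`
the density is multiplied exactly by `(1 - t)^m`, with m = N - p, N - sp or N + β, and elsewhere by
a factor between `(1 - tL)^K` and `(1 - tL)^(-K)`. The Lipschitz constant L is the same for all n,
so letting t → 0 and then n → ∞ leaves only `-m E(u)` as first variation (`energy_slope`).

The source term has the opposite sign, so convexity must be used at `u_t` instead of `u`. The price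
is the integral of `|x|^α |Φ_q(u_t) - Φ_q(u)| |u_t - u|`. Boundedness of u and the weak gradient
make this o(t): `u_t - u` is O(t) in L¹ on the annulus where the deformation acts, and a smooth
approximation of u in W^{1,1} there gains the missing smallness (`setIntegral_deform_sub_le`,
`remainder_isLittleO`).

With σ the order of the solution space, `pohozaev_inequality` reads `(N - σp)/p ⟨ℒu,u⟩ + (N + β)/p B
≤ (N + α)/q A`, where B and A are the weighted p- and q-integrals of u. Testing with u gives ⟨ℒu,u⟩
+ B = A. Since β ≥ 0, this yields `(N - σp)/p A ≤ (N + α)/q A`, and supercriticality of q forces A =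
0. -/

namespace MixedHenon

open Filter Topology
open scoped NNReal

noncomputable section

/-! ### Mollification and local density of smooth functions in W^{1,1} -/

section Mollification

variable {N : ℕ} {F : Type*} [NormedAddCommGroup F] [NormedSpace ℝ F]

/-- Mollification of `f` by a normalized smooth bump. -/
def mollify (φ : ContDiffBump (0 : E N)) (f : E N → F) : E N → F :=
  convolution (φ.normed volume) f (ContinuousLinearMap.lsmul ℝ ℝ) volume

lemma mollify_apply (φ : ContDiffBump (0 : E N)) (f : E N → F) (x : E N) :
    mollify φ f x = ∫ t, φ.normed volume t • f (x - t) := rfl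

lemma integrable_bump (φ : ContDiffBump (0 : E N)) : Integrable (φ.normed volume) volume :=
  φ.integrable_normed

lemma integrable_mollify (φ : ContDiffBump (0 : E N)) {f : E N → F} (hf : Integrable f volume) :
    Integrable (mollify φ f) volume :=
  (integrable_bump φ).integrable_convolution _ hf

lemma mollify_integrand_integrable (φ : ContDiffBump (0 : E N)) {f : E N → F}
    (hf : LocallyIntegrable f volume) (x : E N) :
    Integrable (fun t => φ.normed volume t • f (x - t)) volume :=
  (φ.hasCompactSupport_normed.convolutionExists_left (ContinuousLinearMap.lsmul ℝ ℝ)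
    φ.continuous_normed hf) x

lemma mollify_sub (φ : ContDiffBump (0 : E N)) {f g : E N → F}
    (hf : LocallyIntegrable f volume) (hg : LocallyIntegrable g volume) (x : E N) :
    mollify φ (fun y => f y - g y) x = mollify φ f x - mollify φ g x := by
  simp only [mollify_apply, smul_sub]
  exact integral_sub (mollify_integrand_integrable φ hf x) (mollify_integrand_integrable φ hg x)

/-- The kernel is nonnegative with mass one, so the norm of the mollification is pointwise at most
the mollification of the norm, whose integral is unchanged by Fubini. -/
lemma integral_norm_mollify_le [CompleteSpace F] (φ : ContDiffBump (0 : E N)) {f : E N → F}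
    (hf : Integrable f volume) : ∫ x, ‖mollify φ f x‖ ≤ ∫ x, ‖f x‖ := by
  have h2 : ∫ x, mollify φ (fun y => ‖f y‖) x = ∫ x, ‖f x‖ := by
    unfold mollify
    rw [integral_convolution _ (integrable_bump φ) hf.norm, φ.integral_normed]
    simp
  rw [← h2]
  refine integral_mono (integrable_mollify φ hf).norm (integrable_mollify φ hf.norm) fun x => ?_
  simp only [mollify_apply]
  refine (norm_integral_le_integral_norm _).trans (le_of_eq ?_)
  refine integral_congr_ae (Eventually.of_forall fun t => ?_)
  simp [norm_smul, abs_of_nonneg (φ.nonneg_normed t)]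

lemma mollify_eq_of_eqOn (φ : ContDiffBump (0 : E N)) {f g : E N → F} {x : E N}
    (h : ∀ y, dist y x < φ.rOut → f y = g y) : mollify φ f x = mollify φ g x := by
  simp only [mollify_apply]
  refine integral_congr_ae (Eventually.of_forall fun t => ?_)
  by_cases ht : φ.normed volume t = 0
  · simp [ht]
  · have : t ∈ Function.support (φ.normed volume) := ht
    rw [φ.support_normed_eq] at this
    simp only
    rw [h]
    simpa [dist_eq_norm] using this

/-- Density of continuous compactly supported functions: the L¹ contraction property controls the
mollification of `f - g`, and uniform continuity controls `g`, whose mollification lives in the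
1-thickening of its support. -/
lemma exists_integral_norm_mollify_sub_lt [CompleteSpace F] {f : E N → F}
    (hf : Integrable f volume) {ε : ℝ} (hε : 0 < ε) :
    ∃ δ > 0, ∀ φ : ContDiffBump (0 : E N), φ.rOut < δ → ∫ x, ‖mollify φ f x - f x‖ < ε := by
  obtain ⟨g, hgc, hfg, hgcont, hgi⟩ :=
    hf.exists_hasCompactSupport_integral_sub_le (ε := ε / 4) (by positivity)
  set K := Metric.cthickening 1 (tsupport g) with hK
  have hKc : IsCompact K := hgc.isCompact.cthickening
  have hKfin : volume K ≠ ⊤ := hKc.measure_lt_top.ne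
  set m := volume.real K with hm
  have hm0 : 0 ≤ m := measureReal_nonneg
  obtain ⟨δ, hδ, hgδ⟩ := Metric.uniformContinuous_iff.1
    (hgc.uniformContinuous_of_continuous hgcont) (ε / (4 * (m + 1))) (by positivity)
  refine ⟨min δ 1, by positivity, fun φ hφ => ?_⟩
  have hφδ := hφ.trans_le (min_le_left _ _)
  have hφ1 := hφ.trans_le (min_le_right _ _)
  have e1 : ∫ x, ‖mollify φ g x - g x‖ ≤ ε / 4 := by
    have hpt : ∀ x, ‖mollify φ g x - g x‖ ≤ K.indicator (fun _ => ε / (4 * (m + 1))) x := by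
      intro x
      by_cases hx : x ∈ K
      · rw [Set.indicator_of_mem hx, ← dist_eq_norm]
        refine ContDiffBump.dist_normed_convolution_le hgcont.aestronglyMeasurable fun y hy => ?_
        exact (hgδ ((Metric.mem_ball.1 hy).trans hφδ)).le
      · rw [Set.indicator_of_notMem hx]
        have hz : ∀ y, dist y x < φ.rOut → g y = (fun _ => (0 : F)) y := by
          intro y hy
          by_contra hne
          refine hx (Metric.mem_cthickening_of_dist_le x y 1 _ (subset_tsupport g hne) ?_)
          rw [dist_comm]; linarith
        have h0 : g x = 0 := hz x (by simpa using φ.rOut_pos)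
        rw [mollify_eq_of_eqOn φ hz, h0]
        simp [mollify_apply]
    calc ∫ x, ‖mollify φ g x - g x‖ ≤ ∫ x, K.indicator (fun _ => ε / (4 * (m + 1))) x := by
          refine integral_mono ((integrable_mollify φ hgi).sub hgi).norm ?_ hpt
          exact (integrable_indicator_iff hKc.measurableSet).2 (by simp [hKfin, lt_top_iff_ne_top])
      _ = m * (ε / (4 * (m + 1))) := by
          rw [integral_indicator hKc.measurableSet]; simp [hm]
      _ ≤ ε / 4 := by
          rw [mul_div_assoc', div_le_div_iff₀ (by positivity) (by positivity)]
          nlinarith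
  have hfg' : Integrable (fun x => f x - g x) volume := hf.sub hgi
  have e2 := integral_norm_mollify_le φ hfg'
  have hpt : ∀ x, ‖mollify φ f x - f x‖ ≤
      ‖mollify φ (fun y => f y - g y) x‖ + ‖mollify φ g x - g x‖ + ‖f x - g x‖ := by
    intro x
    rw [mollify_sub φ hf.locallyIntegrable hgi.locallyIntegrable]
    calc ‖mollify φ f x - f x‖ = ‖(mollify φ f x - mollify φ g x) + (mollify φ g x - g x)
          - (f x - g x)‖ := by congr 1; abel
      _ ≤ _ := (norm_sub_le _ _).trans (by gcongr; exact norm_add_le _ _)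
  have i1 := (integrable_mollify φ hfg').norm
  have i2 : Integrable (fun x => ‖mollify φ g x - g x‖) volume :=
    ((integrable_mollify φ hgi).sub hgi).norm
  have i12 : Integrable (fun x => ‖mollify φ (fun y => f y - g y) x‖ + ‖mollify φ g x - g x‖)
      volume := i1.add i2
  calc ∫ x, ‖mollify φ f x - f x‖ ≤ ∫ x, (‖mollify φ (fun y => f y - g y) x‖
        + ‖mollify φ g x - g x‖ + ‖f x - g x‖) :=
        integral_mono ((integrable_mollify φ hf).sub hf).norm (i12.add hfg'.norm) hpt
    _ = (∫ x, ‖mollify φ (fun y => f y - g y) x‖) + (∫ x, ‖mollify φ g x - g x‖)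
        + ∫ x, ‖f x - g x‖ := by
        rw [integral_add i12 hfg'.norm, integral_add i1 i2]
    _ < ε := by linarith

/-- A kernel of radius below 1 sees on `K` only the 1-thickening of `K`, so `f` may be cut off there
and becomes globally integrable. -/
lemma exists_setIntegral_norm_mollify_sub_lt [CompleteSpace F] {f : E N → F}
    (hf : LocallyIntegrable f volume) {K : Set (E N)} (hK : IsCompact K) {ε : ℝ} (hε : 0 < ε) :
    ∃ δ > 0, ∀ φ : ContDiffBump (0 : E N), φ.rOut < δ →
      ∫ x in K, ‖mollify φ f x - f x‖ < ε := by
  set K' := Metric.cthickening 1 K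
  have hK' : IsCompact K' := hK.cthickening
  have hi : Integrable (K'.indicator f) volume :=
    (integrable_indicator_iff hK'.measurableSet).2 (hf.integrableOn_isCompact hK')
  obtain ⟨δ, hδ, h⟩ := exists_integral_norm_mollify_sub_lt hi hε
  refine ⟨min δ 1, by positivity, fun φ hφ => ?_⟩
  have hφδ := hφ.trans_le (min_le_left _ _)
  have hφ1 := hφ.trans_le (min_le_right _ _)
  refine lt_of_le_of_lt ?_ (h φ hφδ)
  calc ∫ x in K, ‖mollify φ f x - f x‖
      = ∫ x in K, ‖mollify φ (K'.indicator f) x - K'.indicator f x‖ := by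
        refine setIntegral_congr_fun hK.measurableSet fun x hx => ?_
        have hxy : ∀ y, dist y x < φ.rOut → f y = K'.indicator f y := fun y hy => by
          rw [Set.indicator_of_mem]
          exact Metric.mem_cthickening_of_dist_le y x 1 _ hx (by linarith)
        rw [mollify_eq_of_eqOn φ hxy, hxy x (by simpa using φ.rOut_pos)]
    _ ≤ _ := setIntegral_le_integral ((integrable_mollify φ hi).sub hi).norm
        (Eventually.of_forall fun x => norm_nonneg _)

lemma contDiff_mollify (φ : ContDiffBump (0 : E N)) {f : E N → F}
    (hf : LocallyIntegrable f volume) : ContDiff ℝ ∞ (mollify φ f) :=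
  φ.hasCompactSupport_normed.contDiff_convolution_left (n := ⊤) _ φ.contDiff_normed hf

lemma fderiv_mollify (φ : ContDiffBump (0 : E N)) {u : E N → ℝ} {G : E N → E N}
    (h : IsWeakGradient u G) (x e : E N) :
    fderiv ℝ (mollify φ u) x e = inner ℝ (mollify φ G x) e := by
  obtain ⟨hu, hG, hw⟩ := h
  set ρ : E N → ℝ := φ.normed volume with hρ
  have hρs : ContDiff ℝ ∞ ρ := φ.contDiff_normed
  have hρc : HasCompactSupport ρ := φ.hasCompactSupport_normed
  have hρ1 : ContDiff ℝ 1 ρ := hρs.of_le (by exact_mod_cast le_top)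
  have hd := hρc.hasFDerivAt_convolution_left (ContinuousLinearMap.lsmul ℝ ℝ) hρ1 hu x
  have hex := (hρc.fderiv ℝ).convolutionExists_left
    (ContinuousLinearMap.precompL (E N) (ContinuousLinearMap.lsmul ℝ ℝ : ℝ →L[ℝ] ℝ →L[ℝ] ℝ))
    (hρ1.continuous_fderiv one_ne_zero) hu x
  have hd' : fderiv ℝ (mollify φ u) x = _ := hd.fderiv
  rw [hd', convolution_def, ContinuousLinearMap.integral_apply hex]
  -- The derivative of the convolution falls on the kernel. The reflected kernel is the test
  -- function to insert in the definition of the weak gradient; the sign from the reflection cancels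
  -- the one from integration by parts.
  set ψ : E N → ℝ := fun y => ρ (x - y) with hψ
  have hψs : ContDiff ℝ ∞ ψ := hρs.comp (contDiff_const.sub contDiff_id)
  have hψc : HasCompactSupport ψ :=
    hρc.comp_homeomorph (Homeomorph.subLeft x)
  have hψd : ∀ y, fderiv ℝ ψ y e = - fderiv ℝ ρ (x - y) e := by
    intro y
    have h1 : HasFDerivAt (fun y => x - y) (-(ContinuousLinearMap.id ℝ (E N))) y := by
      simpa using (hasFDerivAt_id y).const_sub x
    have h2 : HasFDerivAt ρ (fderiv ℝ ρ (x - y)) (x - y) :=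
      ((hρ1.differentiable one_ne_zero) _).hasFDerivAt
    have := (h2.comp y h1).fderiv
    rw [show ψ = ρ ∘ fun y => x - y from rfl, this]; simp
  have key := hw ψ hψs hψc e
  have hintG : Integrable (fun t => ρ t • G (x - t)) volume := mollify_integrand_integrable φ hG x
  rw [mollify_apply, ← real_inner_comm, ← integral_inner hintG]
  rw [← integral_sub_left_eq_self (fun t => ((ContinuousLinearMap.precompL (E N)
    (ContinuousLinearMap.lsmul ℝ ℝ : ℝ →L[ℝ] ℝ →L[ℝ] ℝ)) (fderiv ℝ ρ t) (u (x - t))) e) volume x,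
    ← integral_sub_left_eq_self (fun t => inner ℝ e (ρ t • G (x - t))) volume x]
  have e1 : ∀ y, ((ContinuousLinearMap.precompL (E N)
    (ContinuousLinearMap.lsmul ℝ ℝ : ℝ →L[ℝ] ℝ →L[ℝ] ℝ)) (fderiv ℝ ρ (x - y)) (u (x - (x - y)))) e
      = -(u y * fderiv ℝ ψ y e) := by
    intro y
    rw [hψd, ContinuousLinearMap.precompL_apply]
    simp [mul_comm]
  have e2 : ∀ y, inner ℝ e (ρ (x - y) • G (x - (x - y))) = ψ y * inner ℝ (G y) e := by
    intro y
    rw [inner_smul_right, sub_sub_cancel, real_inner_comm]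
  simp only [e1, e2, integral_neg, key, neg_neg]

/-- Smooth functions are dense in `W^{1,1}_loc`. -/
theorem IsWeakGradient.exists_contDiff_approx {u : E N → ℝ} {G : E N → E N}
    (h : IsWeakGradient u G) {K : Set (E N)} (hK : IsCompact K) {ε : ℝ} (hε : 0 < ε) :
    ∃ v : E N → ℝ, ContDiff ℝ ∞ v ∧ ∫ x in K, ‖u x - v x‖ < ε ∧
      ∫ x in K, ‖G x - gradient v x‖ < ε := by
  obtain ⟨δ₁, h₁, H₁⟩ := exists_setIntegral_norm_mollify_sub_lt h.1 hK hε
  obtain ⟨δ₂, h₂, H₂⟩ := exists_setIntegral_norm_mollify_sub_lt h.2.1 hK hε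
  set δ := min δ₁ δ₂
  have hδ : 0 < δ := by positivity
  let φ : ContDiffBump (0 : E N) := ⟨δ / 4, δ / 2, by positivity, by linarith⟩
  have hφ : φ.rOut < δ := by simp only [φ]; linarith
  refine ⟨mollify φ u, contDiff_mollify φ h.1, ?_, ?_⟩
  · simpa only [norm_sub_rev] using H₁ φ (hφ.trans_le (min_le_left _ _))
  · have : gradient (mollify φ u) = mollify φ G := by
      ext1 x
      refine ext_inner_right ℝ fun e => ?_
      rw [inner_gradient_left, fderiv_mollify φ h]
    rw [this]
    simpa only [norm_sub_rev] using H₂ φ (hφ.trans_le (min_le_right _ _))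

end Mollification

/-! ### Change of variables and two-sided energy comparison -/

section ChangeOfVariables

variable {α : Type*} [MeasurableSpace α]

/-- `J` is the Jacobian of the measurable automorphism `φ` with respect to `μ`. -/
structure IsJacobian (μ : Measure α) (φ : α ≃ᵐ α) (J : α → ℝ≥0) : Prop where
  measurable : Measurable J
  pos : ∀ x, 0 < J x
  map_eq : (μ.withDensity fun x => (J x : ℝ≥0∞)).map φ = μ

namespace IsJacobian

variable {μ : Measure α} {φ : α ≃ᵐ α} {J : α → ℝ≥0} (h : IsJacobian μ φ J)
include h

lemma integrable_iff {F : Type*} [NormedAddCommGroup F] [NormedSpace ℝ F] {f : α → F} :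
    Integrable f μ ↔ Integrable (fun x => J x • f (φ x)) μ := by
  conv_lhs => rw [← h.map_eq]
  rw [φ.measurableEmbedding.integrable_map_iff,
    integrable_withDensity_iff_integrable_smul h.measurable]
  rfl

lemma integral_eq {F : Type*} [NormedAddCommGroup F] [NormedSpace ℝ F] (f : α → F) :
    ∫ y, f y ∂μ = ∫ x, J x • f (φ x) ∂μ := by
  conv_lhs => rw [← h.map_eq]
  rw [φ.measurableEmbedding.integral_map, integral_withDensity_eq_integral_smul h.measurable]

lemma absolutelyContinuous : μ ≪ μ.withDensity fun x => (J x : ℝ≥0∞) :=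
  withDensity_absolutelyContinuous' h.measurable.coe_nnreal_ennreal.aemeasurable
    (Eventually.of_forall fun x => by simpa using (h.pos x).ne')

lemma ae_comp {p : α → Prop} (hp : ∀ᵐ y ∂μ, p y) : ∀ᵐ x ∂μ, p (φ x) := by
  rw [← h.map_eq] at hp
  have := φ.measurableEmbedding.ae_map_iff.1 hp
  exact h.absolutelyContinuous.ae_le this

lemma ae_of_comp {p : α → Prop} (hp : ∀ᵐ x ∂μ, p (φ x)) : ∀ᵐ y ∂μ, p y := by
  rw [← h.map_eq]
  exact φ.measurableEmbedding.ae_map_iff.2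
    ((withDensity_absolutelyContinuous μ _).ae_le hp)

lemma quasiMeasurePreserving_symm : Measure.QuasiMeasurePreserving φ.symm μ μ :=
  ⟨φ.symm.measurable, Measure.AbsolutelyContinuous.mk fun s hs h0 => by
    rw [Measure.map_apply φ.symm.measurable hs]
    have : ∀ᵐ x ∂μ, φ.symm (φ x) ∉ s := by
      simpa using measure_eq_zero_iff_ae_notMem.1 h0
    exact measure_eq_zero_iff_ae_notMem.2 (h.ae_of_comp this)⟩

lemma quasiMeasurePreserving : Measure.QuasiMeasurePreserving φ μ μ :=
  ⟨φ.measurable, Measure.AbsolutelyContinuous.mk fun s hs h0 => by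
    rw [Measure.map_apply φ.measurable hs]
    exact measure_eq_zero_iff_ae_notMem.2 (h.ae_comp (measure_eq_zero_iff_ae_notMem.1 h0))⟩

lemma prod [SFinite μ] : IsJacobian (μ.prod μ) (φ.prodCongr φ) (fun z => J z.1 * J z.2) where
  measurable := (h.measurable.comp measurable_fst).mul (h.measurable.comp measurable_snd)
  pos z := mul_pos (h.pos _) (h.pos _)
  map_eq := by
    have e := prod_withDensity (μ := μ) (ν := μ) h.measurable.coe_nnreal_ennreal
      h.measurable.coe_nnreal_ennreal
    have := Measure.map_prod_map (μ.withDensity fun x => (J x : ℝ≥0∞))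
      (μ.withDensity fun x => (J x : ℝ≥0∞)) φ.measurable φ.measurable
    rw [h.map_eq, e] at this
    conv_rhs => rw [this]
    congr 1

/-- Comparison of an energy `∫ e'` with `∫ e` when the transported density `J (e' ∘ φ)`
lies between `l e` and `k e`, and equals `κ e` on a large set `S`. -/
lemma energy_bounds {e e' : α → ℝ} {S : Set α} {l k κ : ℝ} (he : Integrable e μ)
    (he0 : ∀ x, 0 ≤ e x) (hS : MeasurableSet S)
    (hm : AEStronglyMeasurable (fun x => (J x : ℝ) * e' (φ x)) μ) (hl0 : 0 ≤ l)
    (hl : ∀ᵐ x ∂μ, l * e x ≤ J x * e' (φ x)) (hk : ∀ᵐ x ∂μ, J x * e' (φ x) ≤ k * e x)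
    (hκ : ∀ᵐ x ∂μ, x ∈ S → J x * e' (φ x) = κ * e x) :
    Integrable e' μ ∧
      ∫ x, e' x ∂μ ≤ κ * ∫ x, e x ∂μ + (k - κ) * ∫ x in Sᶜ, e x ∂μ ∧
      κ * ∫ x, e x ∂μ + (l - κ) * ∫ x in Sᶜ, e x ∂μ ≤ ∫ x, e' x ∂μ := by
  have hint : Integrable (fun x => (J x : ℝ) * e' (φ x)) μ := by
    refine (he.const_mul k).mono' hm ?_
    filter_upwards [hl, hk] with x h1 h2
    rw [Real.norm_of_nonneg ((mul_nonneg hl0 (he0 x)).trans h1)]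
    exact h2
  have heq : ∫ x, e' x ∂μ = ∫ x, (J x : ℝ) * e' (φ x) ∂μ := h.integral_eq e'
  -- Both claimed bounds are κ times the integral over `S` plus c times the integral over the
  -- complement, with c = k above and c = l below.
  have hsplit : ∀ c : ℝ, κ * ∫ x, e x ∂μ + (c - κ) * ∫ x in Sᶜ, e x ∂μ
      = κ * (∫ x in S, e x ∂μ) + c * ∫ x in Sᶜ, e x ∂μ := fun c => by
    rw [← integral_add_compl hS he]; ring
  have hin : ∫ x in S, (J x : ℝ) * e' (φ x) ∂μ = κ * ∫ x in S, e x ∂μ := by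
    rw [← integral_const_mul]
    exact setIntegral_congr_ae hS hκ
  refine ⟨h.integrable_iff.2 hint, ?_, ?_⟩
  · rw [hsplit, heq, ← integral_add_compl hS hint, hin, ← integral_const_mul k]
    exact add_le_add le_rfl
      (setIntegral_mono_ae hint.integrableOn (he.const_mul k).integrableOn hk)
  · rw [hsplit, heq, ← integral_add_compl hS hint, hin, ← integral_const_mul l]
    exact add_le_add le_rfl
      (setIntegral_mono_ae (he.const_mul l).integrableOn hint.integrableOn hl)

end IsJacobian

end ChangeOfVariables

/-! ### Radial bi-Lipschitz diffeomorphisms and their Jacobians -/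

section Deformation

/-- A radial `C¹` diffeomorphism of `ℝ^N` fixing the origin, bi-Lipschitz with constant `a⁻¹`. -/
structure Deformation (N : ℕ) where
  toHomeo : E N ≃ₜ E N
  a : ℝ
  a_pos : 0 < a
  a_le : a ≤ 1
  contDiff : ContDiff ℝ 1 toHomeo
  lower : ∀ x y, a * ‖x - y‖ ≤ ‖toHomeo x - toHomeo y‖
  upper : ∀ x y, ‖toHomeo x - toHomeo y‖ ≤ a⁻¹ * ‖x - y‖
  fderiv_lower : ∀ x v, a * ‖v‖ ≤ ‖fderiv ℝ toHomeo x v‖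
  map_zero : toHomeo 0 = 0
  radial : ∀ x y, ‖x‖ = ‖y‖ → ‖toHomeo.symm x‖ = ‖toHomeo.symm y‖

namespace Deformation

variable {N : ℕ} (D : Deformation N)

lemma differentiable : Differentiable ℝ D.toHomeo := D.contDiff.differentiable one_ne_zero

lemma fderiv_upper (x v : E N) : ‖fderiv ℝ D.toHomeo x v‖ ≤ D.a⁻¹ * ‖v‖ := by
  have hlip : LipschitzWith (Real.toNNReal D.a⁻¹) D.toHomeo :=
    LipschitzWith.of_dist_le_mul fun x y => by
      rw [dist_eq_norm, dist_eq_norm, Real.coe_toNNReal _ (inv_nonneg.2 D.a_pos.le)]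
      exact D.upper x y
  have := norm_fderiv_le_of_lipschitz ℝ (x₀ := x) hlip
  rw [Real.coe_toNNReal _ (inv_nonneg.2 D.a_pos.le)] at this
  exact ContinuousLinearMap.le_of_opNorm_le _ this v

/-- The derivative as a linear equivalence. -/
def fderivEquiv (x : E N) : E N ≃L[ℝ] E N :=
  (LinearEquiv.ofInjectiveEndo (fderiv ℝ D.toHomeo x : E N →ₗ[ℝ] E N) (by
    refine (injective_iff_map_eq_zero _).2 fun v hv => ?_
    have := D.fderiv_lower x v
    rw [show fderiv ℝ D.toHomeo x v = 0 from hv, norm_zero] at this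
    exact norm_le_zero_iff.1 (by nlinarith [D.a_pos, norm_nonneg v]))).toContinuousLinearEquiv

lemma fderivEquiv_coe (x : E N) :
    (D.fderivEquiv x : E N →L[ℝ] E N) = fderiv ℝ D.toHomeo x := by
  ext v : 1
  rfl

lemma fderivEquiv_apply (x v : E N) : D.fderivEquiv x v = fderiv ℝ D.toHomeo x v := by
  rw [← D.fderivEquiv_coe]; rfl

lemma hasFDerivAt (x : E N) :
    HasFDerivAt D.toHomeo (D.fderivEquiv x : E N →L[ℝ] E N) x := by
  rw [fderivEquiv_coe]; exact (D.differentiable x).hasFDerivAt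

lemma contDiff_symm : ContDiff ℝ 1 D.toHomeo.symm :=
  D.toHomeo.contDiff_symm D.hasFDerivAt D.contDiff

lemma fderiv_symm (x : E N) :
    fderiv ℝ D.toHomeo.symm (D.toHomeo x) = (D.fderivEquiv x).symm := by
  refine HasFDerivAt.fderiv (HasFDerivAt.of_local_left_inverse
    D.toHomeo.symm.continuous.continuousAt ?_ (Eventually.of_forall D.toHomeo.apply_symm_apply))
  rw [D.toHomeo.symm_apply_apply]
  exact D.hasFDerivAt x

/-- The absolute value of the Jacobian determinant. -/
def jac (x : E N) : ℝ≥0 := ‖(fderiv ℝ D.toHomeo x).det‖₊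

/-- The absolute determinant is the volume ratio of the image of the unit ball, and that image is
squeezed between the balls of radius `a` and `a⁻¹`. -/
lemma jac_mem (x : E N) : D.a ^ N ≤ D.jac x ∧ (D.jac x : ℝ) ≤ D.a⁻¹ ^ N := by
  set A := fderiv ℝ D.toHomeo x with hA
  have ha := D.a_pos
  have hv := Measure.addHaar_image_continuousLinearMap volume A (Metric.ball 0 1)
  have hb0 : (0 : ℝ≥0∞) < volume (Metric.ball (0 : E N) 1) := Metric.measure_ball_pos _ _ one_pos
  have hbt : volume (Metric.ball (0 : E N) 1) ≠ ⊤ := measure_ball_lt_top.ne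
  have hball : ∀ r : ℝ, 0 < r → volume (Metric.ball (0 : E N) r)
      = ENNReal.ofReal (r ^ N) * volume (Metric.ball (0 : E N) 1) := fun r hr => by
    have := Measure.addHaar_ball_of_pos (volume : Measure (E N)) 0 hr
    simpa using this
  have hj : (D.jac x : ℝ) = |A.det| := rfl
  rw [hj]
  constructor
  · have hsub : Metric.ball (0 : E N) D.a ⊆ A '' Metric.ball 0 1 := by
      intro v hv
      refine ⟨(D.fderivEquiv x).symm v, ?_, ?_⟩
      · have := D.fderiv_lower x ((D.fderivEquiv x).symm v)
        rw [← fderivEquiv_apply, ContinuousLinearEquiv.apply_symm_apply] at this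
        rw [mem_ball_zero_iff] at hv ⊢
        by_contra! hcon
        nlinarith
      · rw [hA, ← fderivEquiv_apply, ContinuousLinearEquiv.apply_symm_apply]
    have h1 := measure_mono (μ := volume) hsub
    rw [hv, hball _ ha, ENNReal.mul_le_mul_iff_left hb0.ne' hbt] at h1
    exact (ENNReal.ofReal_le_ofReal_iff (abs_nonneg _)).1 h1
  · have hsub : A '' Metric.ball 0 1 ⊆ Metric.ball (0 : E N) D.a⁻¹ := by
      rintro _ ⟨v, hv, rfl⟩
      rw [mem_ball_zero_iff] at hv ⊢
      have := D.fderiv_upper x v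
      have h2 : 0 < D.a⁻¹ := inv_pos.2 ha
      nlinarith
    have h1 := measure_mono (μ := volume) hsub
    rw [hv, hball _ (inv_pos.2 ha), ENNReal.mul_le_mul_iff_left hb0.ne' hbt] at h1
    exact (ENNReal.ofReal_le_ofReal_iff (by positivity)).1 h1

lemma continuous_jac : Continuous D.jac := by
  have h1 : Continuous (fderiv ℝ D.toHomeo) := D.contDiff.continuous_fderiv one_ne_zero
  exact (ContinuousLinearMap.continuous_det.comp h1).nnnorm

lemma isJacobian : IsJacobian volume D.toHomeo.toMeasurableEquiv D.jac where
  measurable := D.continuous_jac.measurable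
  pos x := by
    have := (D.jac_mem x).1
    have h2 : 0 < D.a ^ N := pow_pos D.a_pos _
    exact_mod_cast h2.trans_le this
  map_eq := by
    have := map_withDensity_abs_det_fderiv_eq_addHaar (volume : Measure (E N))
      (s := Set.univ) (f := D.toHomeo) (f' := fderiv ℝ D.toHomeo) nullMeasurableSet_univ
      (fun x _ => (D.differentiable x).hasFDerivAt.hasFDerivWithinAt)
      D.toHomeo.injective.injOn
    rw [Set.image_univ, D.toHomeo.surjective.range_eq, Measure.restrict_univ] at this
    have hJ : (fun x => (D.jac x : ℝ≥0∞))
        = fun x => ENNReal.ofReal |(fderiv ℝ D.toHomeo x).det| := by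
      ext1 x
      rw [← Real.norm_eq_abs, ofReal_norm]
      rfl
    rw [hJ]
    exact this

lemma norm_symm_sub_le (x y : E N) :
    ‖D.toHomeo.symm x - D.toHomeo.symm y‖ ≤ D.a⁻¹ * ‖x - y‖ := by
  have := D.lower (D.toHomeo.symm x) (D.toHomeo.symm y)
  simp only [Homeomorph.apply_symm_apply] at this
  rw [inv_mul_eq_div, le_div_iff₀ D.a_pos]
  linarith

/-- Integral of a composition with the inverse over a compact set. -/
lemma setIntegral_norm_comp_symm_le {F : Type*} [NormedAddCommGroup F] {f : E N → F}
    (hf : LocallyIntegrable f volume) {K : Set (E N)} (hK : IsCompact K) :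
    IntegrableOn (fun y => f (D.toHomeo.symm y)) K volume ∧
    ∫ y in K, ‖f (D.toHomeo.symm y)‖ ≤ D.a⁻¹ ^ N * ∫ x in D.toHomeo.symm '' K, ‖f x‖ := by
  have hK' : IsCompact (D.toHomeo.symm '' K) := hK.image D.toHomeo.symm.continuous
  have hi := hf.integrableOn_isCompact hK'
  have hm : AEStronglyMeasurable (fun y => f (D.toHomeo.symm y)) volume :=
    hf.aestronglyMeasurable.comp_quasiMeasurePreserving D.isJacobian.quasiMeasurePreserving_symm
  have hind : ∀ x, D.jac x • K.indicator (fun y => ‖f (D.toHomeo.symm y)‖) (D.toHomeo x)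
      = (D.toHomeo.symm '' K).indicator (fun x => (D.jac x : ℝ) * ‖f x‖) x := by
    intro x
    by_cases hx : D.toHomeo x ∈ K
    · have hx' : x ∈ D.toHomeo.symm '' K := ⟨_, hx, by simp⟩
      rw [Set.indicator_of_mem hx, Set.indicator_of_mem hx', D.toHomeo.symm_apply_apply]; rfl
    · have hx' : x ∉ D.toHomeo.symm '' K := by
        rintro ⟨y, hy, rfl⟩; exact hx (by simpa using hy)
      rw [Set.indicator_of_notMem hx, Set.indicator_of_notMem hx', smul_zero]
  have hJi : IntegrableOn (fun x => (D.jac x : ℝ) * ‖f x‖) (D.toHomeo.symm '' K) volume := by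
    refine (hi.norm.const_mul (D.a⁻¹ ^ N)).mono'
      ((NNReal.continuous_coe.comp D.continuous_jac).aestronglyMeasurable.mul
        hi.aestronglyMeasurable.norm) (Eventually.of_forall fun x => ?_)
    rw [norm_mul, norm_norm, Real.norm_of_nonneg (NNReal.coe_nonneg _)]
    gcongr
    exact (D.jac_mem x).2
  have hI : Integrable (K.indicator fun y => ‖f (D.toHomeo.symm y)‖) volume := by
    rw [D.isJacobian.integrable_iff]
    exact ((integrable_indicator_iff hK'.measurableSet).2 hJi).congr
      (Eventually.of_forall fun x => (hind x).symm)
  refine ⟨(integrable_norm_iff hm.restrict).1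
    ((integrable_indicator_iff hK.measurableSet).1 hI), ?_⟩
  have heq : ∫ x, D.jac x • K.indicator (fun y => ‖f (D.toHomeo.symm y)‖)
      (D.toHomeo.toMeasurableEquiv x)
      = ∫ x, (D.toHomeo.symm '' K).indicator (fun x => (D.jac x : ℝ) * ‖f x‖) x :=
    integral_congr_ae (Eventually.of_forall hind)
  rw [← integral_indicator hK.measurableSet, D.isJacobian.integral_eq, heq,
    integral_indicator hK'.measurableSet, ← integral_const_mul]
  refine integral_mono hJi (hi.norm.const_mul _) fun x => ?_
  simp only
  gcongr
  exact (D.jac_mem x).2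

lemma locallyIntegrable_comp_symm {F : Type*} [NormedAddCommGroup F] {f : E N → F}
    (hf : LocallyIntegrable f volume) :
    LocallyIntegrable (fun y => f (D.toHomeo.symm y)) volume :=
  locallyIntegrable_iff.2 fun _ hK => (D.setIntegral_norm_comp_symm_le hf hK).1

end Deformation

end Deformation

/-! ### The truncated dilation field -/

section DilationField

variable {N : ℕ}

/-- A radial cutoff profile: `1` on `[0, 1]` and `0` on `[√2, ∞)`. -/
def cutoff (r : ℝ) : ℝ := Real.smoothTransition (2 - r ^ 2)

lemma cutoff_nonneg (r : ℝ) : 0 ≤ cutoff r := Real.smoothTransition.nonneg _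

lemma cutoff_le_one (r : ℝ) : cutoff r ≤ 1 := Real.smoothTransition.le_one _

lemma cutoff_of_le {r : ℝ} (h0 : 0 ≤ r) (h : r ≤ 1) : cutoff r = 1 :=
  Real.smoothTransition.one_of_one_le (by nlinarith)

lemma cutoff_of_two_le {r : ℝ} (h : 2 ≤ r) : cutoff r = 0 :=
  Real.smoothTransition.zero_of_nonpos (by nlinarith)

/-- The field `x ↦ x`, truncated to a compact set. -/
def truncId (x : E N) : E N := cutoff ‖x‖ • x

lemma contDiff_truncId : ContDiff ℝ ∞ (truncId : E N → E N) := by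
  -- The cutoff depends on the squared norm, which keeps the field smooth at the origin.
  have h : ContDiff ℝ ∞ fun x : E N => 2 - ‖x‖ ^ 2 := contDiff_const.sub (contDiff_norm_sq ℝ)
  exact (Real.smoothTransition.contDiff.comp h).smul contDiff_id

lemma hasCompactSupport_truncId : HasCompactSupport (truncId : E N → E N) := by
  refine HasCompactSupport.intro (isCompact_closedBall (0 : E N) 2) fun x hx => ?_
  rw [mem_closedBall_zero_iff, not_le] at hx
  simp [truncId, cutoff_of_two_le hx.le]

lemma exists_lipschitz_truncId (N : ℕ) :
    ∃ C : ℝ≥0, LipschitzWith C (truncId : E N → E N) := by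
  obtain ⟨C, hC⟩ := (contDiff_truncId (N := N)).lipschitzWith_of_hasCompactSupport
    hasCompactSupport_truncId (by simp)
  exact ⟨C, hC⟩

/-- A Lipschitz constant of all the fields `dilField n`. -/
def fieldLip (N : ℕ) : ℝ := 2 * (exists_lipschitz_truncId N).choose + 1

lemma one_le_fieldLip : 1 ≤ fieldLip N := by
  have : (0 : ℝ) ≤ (exists_lipschitz_truncId N).choose := NNReal.coe_nonneg _
  unfold fieldLip; linarith

lemma fieldLip_pos : 0 < fieldLip N := one_pos.trans_le one_le_fieldLip

/-- The dilation field `x ↦ x`, truncated near the origin and near infinity. -/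
def dilField (n : ℕ) (x : E N) : E N :=
  (n + 1 : ℝ) • truncId ((n + 1 : ℝ)⁻¹ • x) - (n + 1 : ℝ)⁻¹ • truncId ((n + 1 : ℝ) • x)

/-- The profile of `dilField n`. -/
def dilProfile (n : ℕ) (r : ℝ) : ℝ := cutoff ((n + 1 : ℝ)⁻¹ * r) - cutoff ((n + 1 : ℝ) * r)

lemma dilField_eq (n : ℕ) (x : E N) : dilField n x = dilProfile n ‖x‖ • x := by
  have hn : (0 : ℝ) < n + 1 := by positivity
  simp only [dilField, truncId, dilProfile, norm_smul, norm_inv, Real.norm_of_nonneg hn.le,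
    smul_smul, sub_smul]
  congr 2 <;> field_simp

lemma contDiff_dilField (n : ℕ) : ContDiff ℝ ∞ (dilField n : E N → E N) := by
  refine ContDiff.sub ?_ ?_
  · exact (contDiff_truncId.comp (contDiff_id.const_smul _)).const_smul _
  · exact (contDiff_truncId.comp (contDiff_id.const_smul _)).const_smul _

/-- The rescaled fields `r • T(r⁻¹ • x)` all have the Lipschitz constant of `T`, and `dilField n` is
a difference of two of them. Independence of n is essential: the error made outside `core N n` then
has a fixed factor and vanishes as n → ∞. -/
lemma norm_dilField_sub_le (n : ℕ) (x y : E N) :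
    ‖dilField n x - dilField n y‖ ≤ fieldLip N * ‖x - y‖ := by
  have hn : (0 : ℝ) < n + 1 := by positivity
  have hC := (exists_lipschitz_truncId N).choose_spec
  set C := (exists_lipschitz_truncId N).choose with hCdef
  have key : ∀ r : ℝ, 0 < r → ‖r • truncId (r⁻¹ • x) - r • truncId (r⁻¹ • y)‖ ≤ C * ‖x - y‖ := by
    intro r hr
    have := hC.dist_le_mul (r⁻¹ • x) (r⁻¹ • y)
    rw [dist_eq_norm, dist_eq_norm, ← smul_sub, norm_smul, norm_inv, Real.norm_of_nonneg hr.le]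
      at this
    rw [← smul_sub, norm_smul, Real.norm_of_nonneg hr.le]
    calc r * _ ≤ r * (C * (r⁻¹ * ‖x - y‖)) := by gcongr
      _ = C * ‖x - y‖ := by field_simp
  have h1 := key _ hn
  have h2 := key _ (inv_pos.2 hn)
  rw [inv_inv] at h2
  have : dilField n x - dilField n y
      = ((n + 1 : ℝ) • truncId ((n + 1 : ℝ)⁻¹ • x) - (n + 1 : ℝ) • truncId ((n + 1 : ℝ)⁻¹ • y))
      - ((n + 1 : ℝ)⁻¹ • truncId ((n + 1 : ℝ) • x)
        - (n + 1 : ℝ)⁻¹ • truncId ((n + 1 : ℝ) • y)) := by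
    simp only [dilField]; abel
  rw [this]
  refine (norm_sub_le _ _).trans ?_
  have := norm_nonneg (x - y)
  unfold fieldLip
  rw [← hCdef]
  nlinarith

lemma dilField_zero (n : ℕ) : dilField n (0 : E N) = 0 := by simp [dilField, truncId]

lemma dilProfile_le_one (n : ℕ) (r : ℝ) : dilProfile n r ≤ 1 := by
  have h1 := cutoff_le_one ((n + 1 : ℝ)⁻¹ * r)
  have h2 := cutoff_nonneg ((n + 1 : ℝ) * r)
  unfold dilProfile; linarith

/-- The annulus outside of which `dilField n` vanishes. -/
def annulus (N n : ℕ) : Set (E N) := {x | (n + 1 : ℝ)⁻¹ ≤ ‖x‖ ∧ ‖x‖ ≤ 2 * (n + 1)}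

lemma isCompact_annulus (n : ℕ) : IsCompact (annulus N n) := by
  refine (isCompact_closedBall (0 : E N) (2 * (n + 1))).of_isClosed_subset ?_ ?_
  · exact (isClosed_le continuous_const continuous_norm).inter
      (isClosed_le continuous_norm continuous_const)
  · intro x hx
    simpa using hx.2

lemma zero_notMem_annulus (n : ℕ) : (0 : E N) ∉ annulus N n := by
  rintro ⟨h, -⟩
  rw [norm_zero] at h
  have : (0 : ℝ) < (n + 1 : ℝ)⁻¹ := by positivity
  linarith

/-- Far out both cutoffs are 0; near the origin both are 1 and the two terms cancel. -/
lemma dilField_of_notMem_annulus {n : ℕ} {x : E N} (hx : x ∉ annulus N n) :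
    dilField n x = 0 := by
  have hn : (1 : ℝ) ≤ n + 1 := by linarith [Nat.cast_nonneg (α := ℝ) n]
  have hn0 : (0 : ℝ) < n + 1 := by positivity
  rw [dilField_eq]
  have h0 := norm_nonneg x
  by_cases h : (n + 1 : ℝ)⁻¹ ≤ ‖x‖
  · have h2 : 2 * (n + 1 : ℝ) < ‖x‖ := by
      by_contra! hc; exact hx ⟨h, hc⟩
    have e1 : 2 ≤ (n + 1 : ℝ)⁻¹ * ‖x‖ := by
      rw [inv_mul_eq_div, le_div_iff₀ hn0]; exact h2.le
    have e2 : 2 ≤ (n + 1 : ℝ) * ‖x‖ := by nlinarith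
    simp [dilProfile, cutoff_of_two_le e1, cutoff_of_two_le e2]
  · push Not at h
    have e2 : (n + 1 : ℝ) * ‖x‖ ≤ 1 := by
      rw [inv_eq_one_div, lt_div_iff₀ hn0] at h; linarith
    have e1 : (n + 1 : ℝ)⁻¹ * ‖x‖ ≤ 1 := by
      rw [inv_mul_eq_div, div_le_one hn0]; nlinarith
    simp [dilProfile, cutoff_of_le (by positivity) e1, cutoff_of_le (by positivity) e2]

/-- The open set on which `dilField n` is the identity. -/
def core (N n : ℕ) : Set (E N) := {x | 2 * (n + 1 : ℝ)⁻¹ < ‖x‖ ∧ ‖x‖ < n + 1}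

lemma isOpen_core (n : ℕ) : IsOpen (core N n) :=
  (isOpen_lt continuous_const continuous_norm).inter (isOpen_lt continuous_norm continuous_const)

lemma dilField_of_mem_core {n : ℕ} {x : E N} (hx : x ∈ core N n) : dilField n x = x := by
  have hn0 : (0 : ℝ) < n + 1 := by positivity
  have e2 : 2 ≤ (n + 1 : ℝ) * ‖x‖ := by
    have := hx.1
    rw [← div_eq_mul_inv, div_lt_iff₀ hn0] at this; linarith
  have e1 : (n + 1 : ℝ)⁻¹ * ‖x‖ ≤ 1 := by
    rw [inv_mul_eq_div, div_le_one hn0]; exact hx.2.le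
  rw [dilField_eq]
  simp [dilProfile, cutoff_of_le (by positivity) e1, cutoff_of_two_le e2]

lemma eventually_mem_core {x : E N} (hx : x ≠ 0) : ∀ᶠ n in atTop, x ∈ core N n := by
  have h0 : 0 < ‖x‖ := norm_pos_iff.2 hx
  have ht : Tendsto (fun n : ℕ => (n + 1 : ℝ)) atTop atTop :=
    tendsto_natCast_atTop_atTop.atTop_add tendsto_const_nhds
  have h2 : Tendsto (fun n : ℕ => 2 * (n + 1 : ℝ)⁻¹) atTop (𝓝 0) := by
    simpa using ht.inv_tendsto_atTop.const_mul (2 : ℝ)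
  exact (h2.eventually_lt_const h0).and (ht.eventually_gt_atTop _)

lemma norm_fderiv_dilField_le (n : ℕ) (x : E N) :
    ‖fderiv ℝ (dilField n) x‖ ≤ fieldLip N := by
  have : LipschitzWith (Real.toNNReal (fieldLip N)) (dilField n : E N → E N) :=
    LipschitzWith.of_dist_le_mul fun x y => by
      rw [dist_eq_norm, dist_eq_norm, Real.coe_toNNReal _ fieldLip_pos.le]
      exact norm_dilField_sub_le n x y
  simpa [Real.coe_toNNReal _ fieldLip_pos.le] using norm_fderiv_le_of_lipschitz ℝ (x₀ := x) this

end DilationField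

/-! ### The deformations x ↦ x - t X_n(x) -/

section Flow

variable {N : ℕ}

/-- The map `x ↦ x - t X_n(x)`. -/
def flow (n : ℕ) (t : ℝ) (x : E N) : E N := x - t • dilField n x

lemma flow_sub_le {n : ℕ} {t : ℝ} (ht : 0 ≤ t) (x y : E N) :
    ‖flow n t x - flow n t y - (x - y)‖ ≤ t * fieldLip N * ‖x - y‖ := by
  have : flow n t x - flow n t y - (x - y) = -(t • (dilField n x - dilField n y)) := by
    simp only [flow, smul_sub]; abel
  rw [this, norm_neg, norm_smul, Real.norm_of_nonneg ht, mul_assoc]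
  gcongr
  exact norm_dilField_sub_le n x y

lemma contDiff_flow (n : ℕ) (t : ℝ) : ContDiff ℝ ∞ (flow n t : E N → E N) :=
  contDiff_id.sub ((contDiff_dilField n).const_smul t)

lemma flow_lower {n : ℕ} {t : ℝ} (ht : 0 ≤ t) (x y : E N) :
    (1 - t * fieldLip N) * ‖x - y‖ ≤ ‖flow n t x - flow n t y‖ := by
  have h1 := flow_sub_le (n := n) ht x y
  have h2 := norm_sub_norm_le (x - y) (flow n t x - flow n t y)
  rw [norm_sub_rev (x - y)] at h2
  linarith

lemma flow_upper {n : ℕ} {t : ℝ} (ht : 0 ≤ t) (htL : t * fieldLip N ≤ 1 / 2) (x y : E N) :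
    ‖flow n t x - flow n t y‖ ≤ (1 - t * fieldLip N)⁻¹ * ‖x - y‖ := by
  have h1 := flow_sub_le (n := n) ht x y
  have h2 := norm_sub_norm_le (flow n t x - flow n t y) (x - y)
  have h3 : ‖flow n t x - flow n t y‖ ≤ (1 + t * fieldLip N) * ‖x - y‖ := by linarith
  refine h3.trans ?_
  gcongr
  have hp : 0 < 1 - t * fieldLip N := by linarith
  -- The inequality 1 + r ≤ 1/(1 - r) lets the single constant `a = 1 - tL` serve in both
  -- directions.
  rw [le_inv_comm₀ (by have := fieldLip_pos (N := N); positivity) hp,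
    inv_eq_one_div, le_div_iff₀ (by have := fieldLip_pos (N := N); positivity)]
  nlinarith [sq_nonneg (t * fieldLip N)]

/-- `flow n t` as a homeomorphism. -/
def flowHomeo (n : ℕ) (t : ℝ) (ht : 0 ≤ t) (htL : t * fieldLip N ≤ 1 / 2) : E N ≃ₜ E N :=
  -- A perturbation of the identity by a map with Lipschitz constant at most 1/2 is a homeomorphism.
  -- The zero-dimensional space is separate because its identity has norm 0.
  ApproximatesLinearOn.toHomeomorph (f' := ContinuousLinearEquiv.refl ℝ (E N))
    (c := Real.toNNReal (t * fieldLip N)) (flow n t)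
    (by
      have h0 : 0 ≤ t * fieldLip N := mul_nonneg ht fieldLip_pos.le
      rw [ApproximatesLinearOn.approximatesLinearOn_iff_lipschitzOnWith]
      refine LipschitzOnWith.of_dist_le_mul fun x _ y _ => ?_
      rw [Real.coe_toNNReal _ h0, dist_eq_norm, dist_eq_norm]
      have e : flow n t x - x - (flow n t y - y) = flow n t x - flow n t y - (x - y) := by abel
      change ‖flow n t x - x - (flow n t y - y)‖ ≤ _
      rw [e]
      exact flow_sub_le (n := n) ht x y)
    (by
      rcases subsingleton_or_nontrivial (E N) with h | h
      · exact Or.inl h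
      · right
        have : ‖((ContinuousLinearEquiv.refl ℝ (E N)).symm : E N →L[ℝ] E N)‖₊ = 1 := by
          simp
        rw [this, inv_one, Real.toNNReal_lt_one]
        linarith)

lemma flowHomeo_apply (n : ℕ) (t : ℝ) (ht : 0 ≤ t) (htL : t * fieldLip N ≤ 1 / 2) (x : E N) :
    flowHomeo n t ht htL x = flow n t x := rfl

lemma fderiv_flow (n : ℕ) (t : ℝ) (x v : E N) :
    fderiv ℝ (flow n t) x v = v - t • fderiv ℝ (dilField n) x v := by
  have h : HasFDerivAt (flow n t)
      (ContinuousLinearMap.id ℝ (E N) - t • fderiv ℝ (dilField n) x) x :=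
    (hasFDerivAt_id x).sub
      ((((contDiff_dilField n).differentiable (by simp)) x).hasFDerivAt.const_smul t)
  rw [h.fderiv]; simp

lemma flow_eq_smul (n : ℕ) (t : ℝ) (x : E N) :
    flow n t x = (1 - t * dilProfile n ‖x‖) • x := by
  rw [flow, dilField_eq, sub_smul, one_smul, smul_smul]

/-- This makes the inverse map spheres into spheres. If x ≠ 0, rescale x to the point `z` with the
norm of y: then `flow n t z` and `flow n t x` are positive multiples of x of equal norm, hence
equal, and injectivity gives z = x. -/
lemma norm_eq_of_norm_flow_eq {n : ℕ} {t : ℝ} (ht : 0 ≤ t) (htL : t * fieldLip N ≤ 1 / 2)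
    {x y : E N} (h : ‖flow n t x‖ = ‖flow n t y‖) : ‖x‖ = ‖y‖ := by
  have hinj : Function.Injective (flow n t : E N → E N) := (flowHomeo n t ht htL).injective
  have h0 : flow n t (0 : E N) = 0 := by simp [flow, dilField_zero]
  rcases eq_or_ne x 0 with rfl | hx
  · rw [h0, norm_zero, eq_comm, norm_eq_zero, ← h0] at h
    rw [hinj h]
  · have hx0 : 0 < ‖x‖ := norm_pos_iff.2 hx
    have ht2 : t ≤ 1 / 2 := by nlinarith [one_le_fieldLip (N := N)]
    have hpos : ∀ r, 0 < 1 - t * dilProfile n r := fun r => by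
      nlinarith [dilProfile_le_one n r]
    set z : E N := (‖y‖ / ‖x‖) • x with hz
    have hzn : ‖z‖ = ‖y‖ := by
      rw [hz, norm_smul, Real.norm_of_nonneg (by positivity)]; field_simp
    have e : flow n t z = flow n t x := by
      have e1 : ‖flow n t x‖ = (1 - t * dilProfile n ‖x‖) * ‖x‖ := by
        rw [flow_eq_smul, norm_smul, Real.norm_of_nonneg (hpos _).le]
      have e2 : ‖flow n t y‖ = (1 - t * dilProfile n ‖y‖) * ‖y‖ := by
        rw [flow_eq_smul, norm_smul, Real.norm_of_nonneg (hpos _).le]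
      rw [e1, e2] at h
      rw [flow_eq_smul n t z, flow_eq_smul n t x, hzn, hz, smul_smul]
      congr 1
      rw [mul_div_assoc', div_eq_iff hx0.ne', h]
    rw [← hinj e, hzn]

/-- The deformation `flow n t` (the identity for the irrelevant values of `t`). -/
def deform (N n : ℕ) (t : ℝ) : Deformation N :=
  if h : 0 < t ∧ t * fieldLip N ≤ 1 / 2 then
    { toHomeo := flowHomeo n t h.1.le h.2
      a := 1 - t * fieldLip N
      a_pos := by linarith [h.2]
      a_le := by nlinarith [h.1, fieldLip_pos (N := N)]
      contDiff := (contDiff_flow n t).of_le (by exact_mod_cast le_top)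
      lower := flow_lower h.1.le
      upper := flow_upper h.1.le h.2
      fderiv_lower := fun x v => by
        change _ ≤ ‖fderiv ℝ (flow n t) x v‖
        rw [fderiv_flow]
        have h1 := norm_sub_norm_le v (t • fderiv ℝ (dilField n) x v)
        have h2 : ‖t • fderiv ℝ (dilField n) x v‖ ≤ t * (fieldLip N * ‖v‖) := by
          rw [norm_smul, Real.norm_of_nonneg h.1.le]
          have := h.1.le
          gcongr
          exact ContinuousLinearMap.le_of_opNorm_le _ (norm_fderiv_dilField_le n x) v
        linarith
      map_zero := by simp [flowHomeo_apply, flow, dilField_zero]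
      radial := fun x y hxy => by
        refine norm_eq_of_norm_flow_eq (n := n) h.1.le h.2 ?_
        rw [← flowHomeo_apply n t h.1.le h.2, ← flowHomeo_apply n t h.1.le h.2]
        simpa using hxy }
  else
    { toHomeo := Homeomorph.refl _
      a := 1
      a_pos := one_pos
      a_le := le_rfl
      contDiff := contDiff_id
      lower := by simp
      upper := by simp
      fderiv_lower := by
        intro x v
        change _ ≤ ‖fderiv ℝ id x v‖
        simp
      map_zero := rfl
      radial := fun x y hxy => hxy }

/-- The parameters for which `flow n t` is a deformation. -/
def Small (N : ℕ) (t : ℝ) : Prop := 0 < t ∧ t * fieldLip N ≤ 1 / 2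

lemma eventually_small (N : ℕ) : ∀ᶠ t in 𝓝[>] (0 : ℝ), Small N t := by
  have h : ∀ᶠ t in 𝓝 (0 : ℝ), t * fieldLip N < 1 / 2 := by
    have : Tendsto (fun t : ℝ => t * fieldLip N) (𝓝 0) (𝓝 (0 * fieldLip N)) :=
      (continuous_id.mul continuous_const).tendsto 0
    rw [zero_mul] at this
    exact this.eventually_lt_const (by norm_num)
  filter_upwards [self_mem_nhdsWithin, nhdsWithin_le_nhds h] with t h1 h2
  exact ⟨h1, h2.le⟩

variable {n : ℕ} {t : ℝ}

lemma Small.pos (h : Small N t) : 0 < t := h.1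

lemma Small.le_half (h : Small N t) : t ≤ 1 / 2 := by
  nlinarith [h.1, h.2, one_le_fieldLip (N := N)]

lemma deform_apply (h : Small N t) (x : E N) :
    (deform N n t).toHomeo x = x - t • dilField n x := by
  have h' : 0 < t ∧ t * fieldLip N ≤ 1 / 2 := h
  simp only [deform, dif_pos h']
  rfl

lemma deform_a (h : Small N t) : (deform N n t).a = 1 - t * fieldLip N := by
  have h' : 0 < t ∧ t * fieldLip N ≤ 1 / 2 := h
  simp only [deform, dif_pos h']

lemma half_le_deform_a (h : Small N t) : 1 / 2 ≤ (deform N n t).a := by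
  rw [deform_a h]; linarith [h.2]

lemma deform_apply_of_mem_core (h : Small N t) {x : E N} (hx : x ∈ core N n) :
    (deform N n t).toHomeo x = (1 - t) • x := by
  rw [deform_apply h, dilField_of_mem_core hx, sub_smul, one_smul]

lemma fderiv_deform_of_mem_core (h : Small N t) {x : E N} (hx : x ∈ core N n) :
    fderiv ℝ (deform N n t).toHomeo x = (1 - t) • ContinuousLinearMap.id ℝ (E N) := by
  have : (deform N n t).toHomeo =ᶠ[𝓝 x] fun y => (1 - t) • y := by
    filter_upwards [(isOpen_core n).mem_nhds hx] with y hy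
    exact deform_apply_of_mem_core h hy
  rw [this.fderiv_eq]
  exact ((hasFDerivAt_id x).const_smul (1 - t)).fderiv

lemma jac_deform_of_mem_core (h : Small N t) {x : E N} (hx : x ∈ core N n) :
    ((deform N n t).jac x : ℝ) = (1 - t) ^ N := by
  have h1 : (0 : ℝ) ≤ 1 - t := by linarith [h.le_half]
  change ‖(fderiv ℝ (deform N n t).toHomeo x).det‖ = _
  rw [fderiv_deform_of_mem_core h hx, ContinuousLinearMap.det, ContinuousLinearMap.toLinearMap_smul,
    LinearMap.det_smul]
  simp [abs_of_nonneg h1]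

lemma deform_apply_of_notMem_annulus (h : Small N t) {x : E N} (hx : x ∉ annulus N n) :
    (deform N n t).toHomeo x = x := by
  rw [deform_apply h, dilField_of_notMem_annulus hx, smul_zero, sub_zero]

/-- A bijection that is the identity off a set preserves that set. -/
lemma deform_mem_annulus_iff (h : Small N t) {x : E N} :
    (deform N n t).toHomeo x ∈ annulus N n ↔ x ∈ annulus N n := by
  constructor
  · intro hx
    by_contra hc
    rw [deform_apply_of_notMem_annulus h hc] at hx
    exact hc hx
  · intro hx
    by_contra hc
    exact hc (by
      rwa [(deform N n t).toHomeo.injective (deform_apply_of_notMem_annulus h hc)])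

lemma deform_symm_image_annulus (h : Small N t) :
    (deform N n t).toHomeo.symm '' annulus N n = annulus N n := by
  ext x
  rw [← deform_mem_annulus_iff (n := n) h, ← Homeomorph.preimage_symm]
  simp

lemma deform_symm_apply_of_notMem_annulus (h : Small N t) {x : E N} (hx : x ∉ annulus N n) :
    (deform N n t).toHomeo.symm x = x := by
  rw [Homeomorph.symm_apply_eq, deform_apply_of_notMem_annulus h hx]

end Flow

/-! ### Weak gradients: uniqueness, closedness, chain rule -/

section WeakGradient

variable {N : ℕ}

lemma HasWeakGradient.isWeakGradient {u : E N → ℝ} (h : HasWeakGradient u) :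
    IsWeakGradient u (weakGrad u) := by
  rw [weakGrad, dif_pos h]
  exact h.choose_spec

lemma continuous_gradient {v : E N → ℝ} (hv : ContDiff ℝ 1 v) : Continuous (gradient v) :=
  (InnerProductSpace.toDual ℝ (E N)).symm.continuous.comp (hv.continuous_fderiv one_ne_zero)

lemma isWeakGradient_gradient {v : E N → ℝ} (hv : ContDiff ℝ 1 v) :
    IsWeakGradient v (gradient v) := by
  refine ⟨hv.continuous.locallyIntegrable, (continuous_gradient hv).locallyIntegrable,
    fun φ hφ hφc e => ?_⟩
  have hφd : Continuous fun x => fderiv ℝ φ x e :=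
    (hφ.continuous_fderiv (by simp)).clm_apply continuous_const
  have hvd : Continuous fun x => fderiv ℝ v x e :=
    (hv.continuous_fderiv one_ne_zero).clm_apply continuous_const
  have hφdc : HasCompactSupport fun x => fderiv ℝ φ x e := hφc.fderiv_apply ℝ e
  rw [integral_mul_fderiv_eq_neg_fderiv_mul_of_integrable
    ((hvd.mul hφ.continuous).integrable_of_hasCompactSupport hφc.mul_left)
    ((hv.continuous.mul hφd).integrable_of_hasCompactSupport hφdc.mul_left)
    ((hv.continuous.mul hφ.continuous).integrable_of_hasCompactSupport hφc.mul_left)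
    (fun x _ => hv.differentiable one_ne_zero x) (fun x _ => hφ.differentiable (by simp) x)]
  congr 1
  refine integral_congr_ae (Eventually.of_forall fun x => ?_)
  simp only [inner_gradient_left]
  ring

lemma integrable_mul_of_compact {f g : E N → ℝ} (hf : LocallyIntegrable f volume)
    (hg : Continuous g) (hgc : HasCompactSupport g) :
    Integrable (fun x => f x * g x) volume := by
  simpa only [smul_eq_mul, mul_comm] using
    hf.integrable_smul_left_of_hasCompactSupport hg hgc

lemma locallyIntegrable_inner {G : E N → E N} (hG : LocallyIntegrable G volume) (e : E N) :
    LocallyIntegrable (fun x => inner ℝ (G x) e) volume := by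
  refine locallyIntegrable_iff.2 fun K hK => ?_
  exact (hG.integrableOn_isCompact hK).inner_const e

lemma IsWeakGradient.integrable_left {u : E N → ℝ} {G : E N → E N} (h : IsWeakGradient u G)
    {φ : E N → ℝ} (hφ : ContDiff ℝ ∞ φ) (hc : HasCompactSupport φ) (e : E N) :
    Integrable (fun x => u x * fderiv ℝ φ x e) volume :=
  integrable_mul_of_compact h.1 ((hφ.continuous_fderiv (by simp)).clm_apply continuous_const)
    (hc.fderiv_apply ℝ e)

lemma integrable_mul_inner {G : E N → E N} (h : LocallyIntegrable G volume)
    {φ : E N → ℝ} (hφ : Continuous φ) (hc : HasCompactSupport φ) (e : E N) :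
    Integrable (fun x => φ x * inner ℝ (G x) e) volume := by
  simpa only [mul_comm] using integrable_mul_of_compact (locallyIntegrable_inner h e) hφ hc

lemma IsWeakGradient.sub {u v : E N → ℝ} {G H : E N → E N} (hu : IsWeakGradient u G)
    (hv : IsWeakGradient v H) : IsWeakGradient (fun x => u x - v x) (fun x => G x - H x) := by
  refine ⟨hu.1.sub hv.1, hu.2.1.sub hv.2.1, fun φ hφ hc e => ?_⟩
  simp only [sub_mul, inner_sub_left, mul_sub]
  rw [integral_sub (hu.integrable_left hφ hc e) (hv.integrable_left hφ hc e),
    integral_sub (integrable_mul_inner hu.2.1 hφ.continuous hc e)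
      (integrable_mul_inner hv.2.1 hφ.continuous hc e),
    hu.2.2 φ hφ hc e, hv.2.2 φ hφ hc e]
  ring

/-- Weak gradients are unique almost everywhere. -/
lemma IsWeakGradient.ae_eq {u : E N → ℝ} {G H : E N → E N} (hG : IsWeakGradient u G)
    (hH : IsWeakGradient u H) : G =ᵐ[volume] H := by
  have hloc : LocallyIntegrable (fun x => G x - H x) volume := hG.2.1.sub hH.2.1
  have := ae_eq_zero_of_integral_contDiff_smul_eq_zero hloc fun φ hφ hc => by
    have hi : Integrable (fun x => φ x • (G x - H x)) volume :=
      hloc.integrable_smul_left_of_hasCompactSupport hφ.continuous hc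
    refine ext_inner_left ℝ fun e => ?_
    rw [← integral_inner hi, inner_zero_right]
    have e1 : ∀ x, inner ℝ e (φ x • (G x - H x))
        = φ x * inner ℝ (G x) e - φ x * inner ℝ (H x) e := fun x => by
      rw [inner_smul_right, inner_sub_right, real_inner_comm, real_inner_comm (H x)]; ring
    simp only [e1]
    rw [integral_sub (integrable_mul_inner hG.2.1 hφ.continuous hc e)
      (integrable_mul_inner hH.2.1 hφ.continuous hc e)]
    have h1 := hG.2.2 φ hφ hc e
    have h2 := hH.2.2 φ hφ hc e
    linarith
  filter_upwards [this] with x hx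
  exact sub_eq_zero.1 hx

lemma abs_integral_le_of_supported {F : Type*} [NormedAddCommGroup F] {f : E N → F} {g : E N → ℝ}
    {K : Set (E N)} (hK : IsCompact K) {C : ℝ}
    (hf : LocallyIntegrable f volume) (hfg : ∀ x, ‖g x‖ ≤ C * ‖f x‖)
    (hg : ∀ x, x ∉ K → g x = 0) : |∫ x, g x| ≤ C * ∫ x in K, ‖f x‖ := by
  have h1 : ∫ x, g x = ∫ x in K, g x :=
    (setIntegral_eq_integral_of_forall_compl_eq_zero hg).symm
  rw [h1, ← integral_const_mul]
  exact norm_integral_le_of_norm_le ((hf.integrableOn_isCompact hK).norm.const_mul C)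
    (Eventually.of_forall hfg)

/-- The relation "`G` is a weak gradient of `u`" is closed in `L¹_loc`. -/
lemma isWeakGradient_of_approx {u : E N → ℝ} {G : E N → E N} (hu : LocallyIntegrable u volume)
    (hG : LocallyIntegrable G volume)
    (h : ∀ K : Set (E N), IsCompact K → ∀ ε > 0, ∃ v H, IsWeakGradient v H ∧
      ∫ x in K, ‖u x - v x‖ ≤ ε ∧ ∫ x in K, ‖G x - H x‖ ≤ ε) : IsWeakGradient u G := by
  refine ⟨hu, hG, fun φ hφ hc e => ?_⟩
  have hφd : Continuous fun x => fderiv ℝ φ x e :=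
    (hφ.continuous_fderiv (by simp)).clm_apply continuous_const
  have hdc : HasCompactSupport fun x => fderiv ℝ φ x e := hc.fderiv_apply ℝ e
  obtain ⟨C₁, hC₁⟩ := hdc.exists_bound_of_continuous hφd
  obtain ⟨C₂, hC₂⟩ := hc.exists_bound_of_continuous hφ.continuous
  have hC₁0 : 0 ≤ C₁ := (norm_nonneg _).trans (hC₁ 0)
  have hC₂0 : 0 ≤ C₂ := (norm_nonneg _).trans (hC₂ 0)
  have key : ∀ ε > 0, |(∫ x, u x * fderiv ℝ φ x e) + ∫ x, φ x * inner ℝ (G x) e|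
      ≤ 0 + (C₁ + C₂ * ‖e‖) * ε := by
    intro ε hε
    obtain ⟨v, H, hv, h1, h2⟩ := h _ hc.isCompact ε hε
    have hvw := hv.2.2 φ hφ hc e
    have e1 : (∫ x, u x * fderiv ℝ φ x e) + ∫ x, φ x * inner ℝ (G x) e
        = (∫ x, (u x - v x) * fderiv ℝ φ x e) + ∫ x, φ x * inner ℝ (G x - H x) e := by
      simp only [sub_mul, inner_sub_left, mul_sub]
      rw [integral_sub (integrable_mul_of_compact hu hφd hdc) (hv.integrable_left hφ hc e),
        integral_sub (integrable_mul_inner hG hφ.continuous hc e)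
          (integrable_mul_inner hv.2.1 hφ.continuous hc e), hvw]
      ring
    have b1 : |∫ x, (u x - v x) * fderiv ℝ φ x e| ≤ C₁ * ∫ x in tsupport φ, ‖u x - v x‖ := by
      refine abs_integral_le_of_supported hc.isCompact (hu.sub hv.1) (fun x => ?_) fun x hx => ?_
      · rw [norm_mul, mul_comm]
        have := hC₁ x
        gcongr
      · rw [fderiv_of_notMem_tsupport ℝ hx]; simp
    have b2 : |∫ x, φ x * inner ℝ (G x - H x) e|
        ≤ (C₂ * ‖e‖) * ∫ x in tsupport φ, ‖G x - H x‖ := by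
      refine abs_integral_le_of_supported hc.isCompact (hG.sub hv.2.1) (fun x => ?_)
        fun x hx => ?_
      · have h3 := hC₂ x
        rw [Real.norm_eq_abs] at h3
        have h4 := abs_real_inner_le_norm (G x - H x) e
        rw [Real.norm_eq_abs, abs_mul]
        calc |φ x| * |inner ℝ (G x - H x) e| ≤ C₂ * (‖G x - H x‖ * ‖e‖) := by gcongr
          _ = _ := by ring
      · rw [image_eq_zero_of_notMem_tsupport hx, zero_mul]
    rw [e1]
    refine (abs_add_le _ _).trans ?_
    have b3 : C₁ * ∫ x in tsupport φ, ‖u x - v x‖ ≤ C₁ * ε := by gcongr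
    have b4 : (C₂ * ‖e‖) * ∫ x in tsupport φ, ‖G x - H x‖ ≤ (C₂ * ‖e‖) * ε := by gcongr
    linarith
  have hz : |(∫ x, u x * fderiv ℝ φ x e) + ∫ x, φ x * inner ℝ (G x) e| ≤ 0 := by
    refine le_of_forall_pos_le_add fun δ hδ => ?_
    have hpos : 0 < C₁ + C₂ * ‖e‖ + 1 := by positivity
    refine (key (δ / (C₁ + C₂ * ‖e‖ + 1)) (by positivity)).trans ?_
    gcongr
    rw [mul_div_assoc', div_le_iff₀ hpos]
    nlinarith
  have := abs_nonpos_iff.1 hz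
  linarith

namespace Deformation

variable (D : Deformation N)

/-- The transported gradient `(Dψ)ᵀ (G ∘ ψ)`, where `ψ` is the inverse of the deformation. -/
def pullGrad (G : E N → E N) (y : E N) : E N :=
  ContinuousLinearMap.adjoint (fderiv ℝ D.toHomeo.symm y) (G (D.toHomeo.symm y))

lemma norm_fderiv_symm_le (y : E N) : ‖fderiv ℝ D.toHomeo.symm y‖ ≤ D.a⁻¹ := by
  have hlip : LipschitzWith (Real.toNNReal D.a⁻¹) D.toHomeo.symm :=
    LipschitzWith.of_dist_le_mul fun x y => by
      rw [dist_eq_norm, dist_eq_norm, Real.coe_toNNReal _ (inv_nonneg.2 D.a_pos.le)]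
      exact D.norm_symm_sub_le x y
  have := norm_fderiv_le_of_lipschitz ℝ (x₀ := y) hlip
  rwa [Real.coe_toNNReal _ (inv_nonneg.2 D.a_pos.le)] at this

lemma norm_pullGrad_le (G : E N → E N) (y : E N) :
    ‖D.pullGrad G y‖ ≤ D.a⁻¹ * ‖G (D.toHomeo.symm y)‖ := by
  refine ContinuousLinearMap.le_of_opNorm_le _ ?_ _
  rw [LinearIsometryEquiv.norm_map]
  exact D.norm_fderiv_symm_le y

lemma adjoint_pullGrad (G : E N → E N) (x : E N) :
    ContinuousLinearMap.adjoint (fderiv ℝ D.toHomeo x) (D.pullGrad G (D.toHomeo x)) = G x := by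
  rw [pullGrad, D.fderiv_symm, D.toHomeo.symm_apply_apply, ← ContinuousLinearMap.comp_apply,
    ← ContinuousLinearMap.adjoint_comp, ← D.fderivEquiv_coe,
    ContinuousLinearEquiv.coe_symm_comp_coe]
  exact ext_inner_right ℝ fun e => by rw [ContinuousLinearMap.adjoint_inner_left]; rfl

/-- The transposed derivative of the deformation undoes the pullback, and its norm is at most `a⁻¹`.
-/
lemma le_norm_pullGrad (G : E N → E N) (x : E N) :
    D.a * ‖G x‖ ≤ ‖D.pullGrad G (D.toHomeo x)‖ := by
  have h2 : ‖ContinuousLinearMap.adjoint (fderiv ℝ D.toHomeo x)‖ ≤ D.a⁻¹ := by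
    rw [LinearIsometryEquiv.norm_map]
    exact ContinuousLinearMap.opNorm_le_bound _ (inv_nonneg.2 D.a_pos.le) (D.fderiv_upper x)
  have h3 := ContinuousLinearMap.le_of_opNorm_le _ h2 (D.pullGrad G (D.toHomeo x))
  rw [D.adjoint_pullGrad, inv_mul_eq_div, le_div_iff₀ D.a_pos] at h3
  linarith

lemma pullGrad_sub (G H : E N → E N) (y : E N) :
    D.pullGrad (fun x => G x - H x) y = D.pullGrad G y - D.pullGrad H y := by
  simp [pullGrad]

lemma continuous_adjoint_fderiv_symm :
    Continuous fun y => ContinuousLinearMap.adjoint (fderiv ℝ D.toHomeo.symm y) :=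
  (LinearIsometryEquiv.continuous _).comp (D.contDiff_symm.continuous_fderiv one_ne_zero)

lemma aestronglyMeasurable_comp_symm {F : Type*} [TopologicalSpace F]
    {f : E N → F} (hf : AEStronglyMeasurable f volume) :
    AEStronglyMeasurable (fun y => f (D.toHomeo.symm y)) volume :=
  hf.comp_quasiMeasurePreserving D.isJacobian.quasiMeasurePreserving_symm

lemma aestronglyMeasurable_pullGrad {G : E N → E N} (hG : AEStronglyMeasurable G volume) :
    AEStronglyMeasurable (D.pullGrad G) volume :=
  isBoundedBilinearMap_apply.continuous.comp_aestronglyMeasurable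
    (D.continuous_adjoint_fderiv_symm.aestronglyMeasurable.prodMk
      (D.aestronglyMeasurable_comp_symm hG))

lemma locallyIntegrable_pullGrad {G : E N → E N} (hG : LocallyIntegrable G volume) :
    LocallyIntegrable (D.pullGrad G) volume := by
  refine locallyIntegrable_iff.2 fun K hK => ?_
  refine (((D.setIntegral_norm_comp_symm_le hG hK).1.norm).const_mul D.a⁻¹).mono'
    (D.aestronglyMeasurable_pullGrad hG.aestronglyMeasurable).restrict
    (Eventually.of_forall (D.norm_pullGrad_le G))

lemma gradient_comp_symm {v : E N → ℝ} (hv : ContDiff ℝ 1 v) :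
    gradient (fun y => v (D.toHomeo.symm y)) = D.pullGrad (gradient v) := by
  ext1 y
  refine ext_inner_right ℝ fun e => ?_
  rw [inner_gradient_left, pullGrad, ContinuousLinearMap.adjoint_inner_left, inner_gradient_left]
  have h1 := (hv.differentiable one_ne_zero (D.toHomeo.symm y)).hasFDerivAt
  have h2 := (D.contDiff_symm.differentiable one_ne_zero y).hasFDerivAt
  have := (h1.comp y h2).fderiv
  rw [show (fun y => v (D.toHomeo.symm y)) = v ∘ D.toHomeo.symm from rfl, this]
  rfl

/-- The chain rule for weak gradients. -/
theorem isWeakGradient_comp_symm {u : E N → ℝ} {G : E N → E N} (h : IsWeakGradient u G) :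
    IsWeakGradient (fun y => u (D.toHomeo.symm y)) (D.pullGrad G) := by
  refine isWeakGradient_of_approx (D.locallyIntegrable_comp_symm h.1)
    (D.locallyIntegrable_pullGrad h.2.1) fun K hK ε hε => ?_
  have ha := D.a_pos
  -- Composition with the inverse costs `a⁻ᴺ` in L¹, and the pullback of a gradient a further `a⁻¹`;
  -- `c` dominates both costs.
  set c : ℝ := D.a⁻¹ ^ N + D.a⁻¹ * D.a⁻¹ ^ N with hc
  have hc0 : 0 < c := by positivity
  obtain ⟨v, hv, h1, h2⟩ := h.exists_contDiff_approx
    (hK.image D.toHomeo.symm.continuous) (ε := ε / c) (by positivity)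
  have hv1 : ContDiff ℝ 1 v := hv.of_le (by exact_mod_cast le_top)
  have hvw := isWeakGradient_gradient hv1
  have hcε : c * (ε / c) = ε := by field_simp
  have hcomp : ContDiff ℝ 1 (fun y => v (D.toHomeo.symm y)) := hv1.comp D.contDiff_symm
  have hw := isWeakGradient_gradient hcomp
  rw [D.gradient_comp_symm hv1] at hw
  refine ⟨_, _, hw, ?_, ?_⟩
  · have h3 := (D.setIntegral_norm_comp_symm_le (h.1.sub hvw.1) hK).2
    refine (h3.trans (mul_le_mul_of_nonneg_left h1.le (by positivity))).trans ?_
    refine le_of_le_of_eq ?_ hcε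
    gcongr
    rw [hc]
    have : 0 ≤ D.a⁻¹ * D.a⁻¹ ^ N := by positivity
    linarith
  · have hloc : LocallyIntegrable (fun x => G x - gradient v x) volume := h.2.1.sub hvw.2.1
    have h3 := D.setIntegral_norm_comp_symm_le hloc hK
    have h4 : ∫ y in K, ‖D.pullGrad G y - D.pullGrad (gradient v) y‖
        ≤ ∫ y in K, D.a⁻¹ * ‖G (D.toHomeo.symm y) - gradient v (D.toHomeo.symm y)‖ := by
      refine setIntegral_mono ?_ (h3.1.norm.const_mul _) fun y => ?_
      · exact (((D.locallyIntegrable_pullGrad h.2.1).sub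
          (D.locallyIntegrable_pullGrad hvw.2.1)).integrableOn_isCompact hK).norm
      · simp only
        rw [← D.pullGrad_sub]
        exact D.norm_pullGrad_le _ y
    rw [integral_const_mul] at h4
    calc _ ≤ _ := h4
      _ ≤ D.a⁻¹ * (D.a⁻¹ ^ N * (ε / c)) := by
        gcongr
        exact h3.2.trans (by gcongr)
      _ ≤ c * (ε / c) := by
        rw [← mul_assoc]
        gcongr
        rw [hc]
        have : 0 ≤ D.a⁻¹ ^ N := by positivity
        linarith
      _ = ε := hcε

lemma weakGrad_comp_symm {u : E N → ℝ} (h : HasWeakGradient u) :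
    HasWeakGradient (fun y => u (D.toHomeo.symm y)) ∧
      weakGrad (fun y => u (D.toHomeo.symm y)) =ᵐ[volume] D.pullGrad (weakGrad u) := by
  have h1 := D.isWeakGradient_comp_symm h.isWeakGradient
  have h2 : HasWeakGradient (fun y => u (D.toHomeo.symm y)) := ⟨_, h1⟩
  exact ⟨h2, h2.isWeakGradient.ae_eq h1⟩

end Deformation

end WeakGradient

/-! ### L¹ estimates of order t for the displacement of u -/

section Displacement

variable {N n : ℕ} {t : ℝ}

lemma exists_norm_dilField_le (N n : ℕ) : ∃ B : ℝ, 0 ≤ B ∧ ∀ x : E N, ‖dilField n x‖ ≤ B := by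
  have hc : HasCompactSupport (dilField n : E N → E N) :=
    HasCompactSupport.intro (isCompact_annulus n) fun x hx => dilField_of_notMem_annulus hx
  obtain ⟨B, hB⟩ := hc.exists_bound_of_continuous (contDiff_dilField n).continuous
  exact ⟨B, (norm_nonneg _).trans (hB 0), hB⟩

lemma inv_deform_a_pow_le (h : Small N t) : (deform N n t).a⁻¹ ^ N ≤ 2 ^ N := by
  have h1 := half_le_deform_a (n := n) h
  have h2 := (deform N n t).a_pos
  refine pow_le_pow_left₀ (inv_nonneg.2 h2.le) ?_ _
  rw [inv_le_comm₀ h2 two_pos]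
  linarith

lemma setIntegral_comp_symm_annulus_le {F : Type*} [NormedAddCommGroup F] (h : Small N t)
    {f : E N → F} (hf : LocallyIntegrable f volume) :
    ∫ y in annulus N n, ‖f ((deform N n t).toHomeo.symm y)‖
      ≤ 2 ^ N * ∫ x in annulus N n, ‖f x‖ := by
  have h1 := ((deform N n t).setIntegral_norm_comp_symm_le hf (isCompact_annulus n)).2
  rw [deform_symm_image_annulus h] at h1
  refine h1.trans ?_
  have : 0 ≤ ∫ x in annulus N n, ‖f x‖ := integral_nonneg fun _ => norm_nonneg _
  exact mul_le_mul_of_nonneg_right (inv_deform_a_pow_le h) this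

/-- The deformation preserves the annulus, and its Jacobian is at least `a^N ≥ 2⁻ᴺ`. -/
lemma setIntegral_comp_annulus_le (h : Small N t) {g : E N → ℝ} (hg : Continuous g)
    (hg0 : ∀ x, 0 ≤ g x) :
    ∫ x in annulus N n, g ((deform N n t).toHomeo x) ≤ 2 ^ N * ∫ x in annulus N n, g x := by
  set D := deform N n t with hD
  have hK := isCompact_annulus (N := N) n
  have hc : Continuous fun x => g (D.toHomeo x) := hg.comp D.toHomeo.continuous
  have hcJ : Continuous fun x => (D.jac x : ℝ) * g (D.toHomeo x) :=
    (NNReal.continuous_coe.comp D.continuous_jac).mul hc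
  have heq : ∫ x in annulus N n, g x = ∫ x in annulus N n, (D.jac x : ℝ) * g (D.toHomeo x) := by
    rw [← integral_indicator hK.measurableSet, D.isJacobian.integral_eq,
      ← integral_indicator hK.measurableSet]
    refine integral_congr_ae (Eventually.of_forall fun x => ?_)
    change D.jac x • (annulus N n).indicator g (D.toHomeo x) = _
    by_cases hx : x ∈ annulus N n
    · rw [Set.indicator_of_mem hx, Set.indicator_of_mem ((deform_mem_annulus_iff h).2 hx)]
      rfl
    · rw [Set.indicator_of_notMem hx,
        Set.indicator_of_notMem (fun hc => hx ((deform_mem_annulus_iff h).1 hc)), smul_zero]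
  rw [heq, ← integral_const_mul]
  refine setIntegral_mono (hc.continuousOn.integrableOn_compact hK)
    ((hcJ.continuousOn.integrableOn_compact hK).const_mul _) fun x => ?_
  have h1 := (D.jac_mem x).1
  have h2 : (1 : ℝ) ≤ 2 ^ N * D.jac x := by
    have h3 : (1 / 2 : ℝ) ^ N ≤ D.a ^ N := by
      have := half_le_deform_a (n := n) h
      gcongr
    calc (1 : ℝ) = 2 ^ N * (1 / 2) ^ N := by rw [← mul_pow]; norm_num
      _ ≤ 2 ^ N * D.jac x := by gcongr; exact h3.trans h1
  simp only
  rw [← mul_assoc]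
  exact le_mul_of_one_le_left (hg0 _) h2

lemma Small.mono {s : ℝ} (h : Small N t) (h0 : 0 < s) (hs : s ≤ t) : Small N s :=
  ⟨h0, (mul_le_mul_of_nonneg_right hs fieldLip_pos.le).trans h.2⟩

lemma norm_sub_flow_le {v : E N → ℝ} (hv : ContDiff ℝ 1 v) {B : ℝ}
    (hB : ∀ x : E N, ‖dilField n x‖ ≤ B) (ht : 0 ≤ t) (x : E N) :
    ‖v x - v (x - t • dilField n x)‖
      ≤ ∫ s in Set.Ioc 0 t, B * ‖gradient v (x - s • dilField n x)‖ := by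
  set X := dilField n x
  have hpath : ∀ s : ℝ, HasDerivAt (fun s : ℝ => x - s • X) (-X) s := fun s => by
    simpa using ((hasDerivAt_id s).smul_const X).const_sub x
  have hd : ∀ s : ℝ, HasDerivAt (fun s : ℝ => v (x - s • X))
      (fderiv ℝ v (x - s • X) (-X)) s := fun s =>
    (hv.differentiable one_ne_zero _).hasFDerivAt.comp_hasDerivAt s (hpath s)
  have hpc : Continuous fun s : ℝ => x - s • X := by fun_prop
  have hcont : Continuous fun s : ℝ => fderiv ℝ v (x - s • X) (-X) :=
    ((hv.continuous_fderiv one_ne_zero).comp hpc).clm_apply continuous_const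
  have hg : Continuous fun s : ℝ => B * ‖gradient v (x - s • X)‖ :=
    continuous_const.mul ((continuous_gradient hv).comp hpc).norm
  have hft := intervalIntegral.integral_eq_sub_of_hasDerivAt (a := 0) (b := t)
    (fun s _ => hd s) (hcont.intervalIntegrable _ _)
  simp only [zero_smul, sub_zero] at hft
  rw [norm_sub_rev, ← hft, ← intervalIntegral.integral_of_le ht]
  refine intervalIntegral.norm_integral_le_of_norm_le ht
    (Eventually.of_forall fun s _ => ?_) (hg.intervalIntegrable _ _)
  rw [← inner_gradient_left]
  refine (norm_inner_le_norm _ _).trans ?_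
  rw [norm_neg, mul_comm]
  gcongr
  exact hB x

/-- Integrate the gradient along the segment from x to its image and exchange the integrals. For
each fixed s the point `x - s X_n(x)` is the image of x under the deformation with parameter s, so
the change of variables bound applies uniformly in s. -/
lemma setIntegral_sub_deform_le {v : E N → ℝ} (hv : ContDiff ℝ 1 v) {B : ℝ} (hB0 : 0 ≤ B)
    (hB : ∀ x : E N, ‖dilField n x‖ ≤ B) (h : Small N t) :
    ∫ x in annulus N n, ‖v x - v ((deform N n t).toHomeo x)‖
      ≤ t * (B * 2 ^ N * ∫ x in annulus N n, ‖gradient v x‖) := by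
  have hK := isCompact_annulus (N := N) n
  have hX : Continuous (dilField n : E N → E N) := (contDiff_dilField n).continuous
  have hjoint : Continuous fun z : E N × ℝ => B * ‖gradient v (z.1 - z.2 • dilField n z.1)‖ := by
    refine continuous_const.mul (((continuous_gradient hv).comp ?_).norm)
    exact continuous_fst.sub (continuous_snd.smul (hX.comp continuous_fst))
  have hint : Integrable (fun z : E N × ℝ => B * ‖gradient v (z.1 - z.2 • dilField n z.1)‖)
      ((volume.restrict (annulus N n)).prod (volume.restrict (Set.Ioc 0 t))) := by
    rw [Measure.prod_restrict]
    exact (hjoint.continuousOn.integrableOn_compact (hK.prod isCompact_Icc)).mono_set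
      (Set.prod_mono_right Set.Ioc_subset_Icc_self)
  calc ∫ x in annulus N n, ‖v x - v ((deform N n t).toHomeo x)‖
      ≤ ∫ x in annulus N n, ∫ s in Set.Ioc 0 t,
          B * ‖gradient v (x - s • dilField n x)‖ := by
        refine setIntegral_mono ?_ hint.integral_prod_left fun x => ?_
        · exact ((hv.continuous.sub (hv.continuous.comp
            (deform N n t).toHomeo.continuous)).norm).continuousOn.integrableOn_compact hK
        · simp only [deform_apply h]
          exact norm_sub_flow_le hv hB h.pos.le x
    _ = ∫ s in Set.Ioc 0 t, ∫ x in annulus N n,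
          B * ‖gradient v (x - s • dilField n x)‖ := integral_integral_swap hint
    _ ≤ ∫ s in Set.Ioc 0 t, (B * 2 ^ N * ∫ x in annulus N n, ‖gradient v x‖) := by
        refine setIntegral_mono_on hint.integral_prod_right (integrable_const _)
          measurableSet_Ioc fun s hs => ?_
        have hs' := h.mono hs.1 hs.2
        have := setIntegral_comp_annulus_le (n := n) hs' (continuous_gradient hv).norm
          (fun _ => norm_nonneg _)
        simp only [deform_apply hs'] at this
        rw [integral_const_mul, mul_assoc]
        gcongr
    _ = _ := by simp [h.pos.le]

lemma setIntegral_deform_sub_le_of_contDiff {v : E N → ℝ} (hv : ContDiff ℝ 1 v) {B : ℝ}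
    (hB0 : 0 ≤ B) (hB : ∀ x : E N, ‖dilField n x‖ ≤ B) (h : Small N t) :
    ∫ y in annulus N n, ‖v ((deform N n t).toHomeo.symm y) - v y‖
      ≤ t * (B * 4 ^ N * ∫ x in annulus N n, ‖gradient v x‖) := by
  set D := deform N n t
  have hf : Continuous fun x => v x - v (D.toHomeo x) :=
    hv.continuous.sub (hv.continuous.comp D.toHomeo.continuous)
  have h1 := setIntegral_comp_symm_annulus_le (n := n) h (hf.locallyIntegrable (μ := volume))
  have h2 := setIntegral_sub_deform_le hv hB0 hB h
  change ∫ y in annulus N n, ‖v (D.toHomeo.symm y) - v (D.toHomeo (D.toHomeo.symm y))‖ ≤ _ at h1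
  simp only [Homeomorph.apply_symm_apply] at h1
  refine (h1.trans (mul_le_mul_of_nonneg_left h2 (by positivity))).trans (le_of_eq ?_)
  rw [show (4 : ℝ) = 2 * 2 by norm_num, mul_pow]
  ring

/-- `u ∘ φ_t⁻¹ - u` is `O(t)` in `L¹`, with the `L¹` norm of the gradient as a constant. -/
theorem setIntegral_deform_sub_le {u : E N → ℝ} {G : E N → E N} (hu : IsWeakGradient u G) {B : ℝ}
    (hB0 : 0 ≤ B) (hB : ∀ x : E N, ‖dilField n x‖ ≤ B) (h : Small N t) :
    ∫ y in annulus N n, ‖u ((deform N n t).toHomeo.symm y) - u y‖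
      ≤ t * (B * 4 ^ N * ∫ x in annulus N n, ‖G x‖) := by
  set D := deform N n t with hD
  have hK := isCompact_annulus (N := N) n
  -- The three summands are the costs of replacing u by v in `u ∘ φ_t⁻¹`, in the gradient, and in u
  -- itself.
  set c : ℝ := 2 ^ N + t * (B * 4 ^ N) + 1 with hc
  have ht := h.pos
  have hc0 : 0 < c := by positivity
  refine le_of_forall_pos_le_add fun ε hε => ?_
  obtain ⟨v, hv, h1, h2⟩ := hu.exists_contDiff_approx hK (ε := ε / c) (by positivity)
  have hv1 : ContDiff ℝ 1 v := hv.of_le (by exact_mod_cast le_top)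
  have hvw := isWeakGradient_gradient hv1
  have h3 := setIntegral_deform_sub_le_of_contDiff hv1 hB0 hB h
  have h4 := setIntegral_comp_symm_annulus_le (n := n) h (hu.1.sub hvw.1)
  simp only [Pi.sub_apply] at h4
  have iu := hu.1.integrableOn_isCompact hK
  have iv := hvw.1.integrableOn_isCompact hK
  have iu' := (D.locallyIntegrable_comp_symm hu.1).integrableOn_isCompact hK
  have iv' := (D.locallyIntegrable_comp_symm hvw.1).integrableOn_isCompact hK
  have iG := hu.2.1.integrableOn_isCompact hK
  have iH := hvw.2.1.integrableOn_isCompact hK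
  have e1 : ∫ y in annulus N n, ‖u (D.toHomeo.symm y) - u y‖
      ≤ (∫ y in annulus N n, ‖u (D.toHomeo.symm y) - v (D.toHomeo.symm y)‖)
        + (∫ y in annulus N n, ‖v (D.toHomeo.symm y) - v y‖)
        + ∫ y in annulus N n, ‖u y - v y‖ := by
    have i1 : IntegrableOn (fun y => ‖u (D.toHomeo.symm y) - v (D.toHomeo.symm y)‖)
      (annulus N n) volume := (iu'.sub iv').norm
    have i2 : IntegrableOn (fun y => ‖v (D.toHomeo.symm y) - v y‖)
      (annulus N n) volume := (iv'.sub iv).norm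
    have i12 : IntegrableOn (fun y => ‖u (D.toHomeo.symm y) - v (D.toHomeo.symm y)‖
      + ‖v (D.toHomeo.symm y) - v y‖) (annulus N n) volume := i1.add i2
    have i3 : IntegrableOn (fun y => ‖u y - v y‖) (annulus N n) volume := (iu.sub iv).norm
    rw [← integral_add i1 i2, ← integral_add i12 i3]
    refine setIntegral_mono (iu'.sub iu).norm (i12.add i3) fun y => ?_
    calc ‖u (D.toHomeo.symm y) - u y‖ = ‖(u (D.toHomeo.symm y) - v (D.toHomeo.symm y))
          + (v (D.toHomeo.symm y) - v y) - (u y - v y)‖ := by congr 1; abel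
      _ ≤ _ := (norm_sub_le _ _).trans (by gcongr; exact norm_add_le _ _)
  have e2 : ∫ x in annulus N n, ‖gradient v x‖
      ≤ (∫ x in annulus N n, ‖G x‖) + ∫ x in annulus N n, ‖G x - gradient v x‖ := by
    have i1 : IntegrableOn (fun x => ‖G x‖) (annulus N n) volume := iG.norm
    have i2 : IntegrableOn (fun x => ‖G x - gradient v x‖) (annulus N n) volume :=
      (iG.sub iH).norm
    rw [← integral_add i1 i2]
    refine setIntegral_mono iH.norm (i1.add i2) fun x => ?_
    calc ‖gradient v x‖ = ‖G x - (G x - gradient v x)‖ := by congr 1; abel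
      _ ≤ _ := norm_sub_le _ _
  have e3 : t * (B * 4 ^ N * ∫ x in annulus N n, ‖gradient v x‖)
      ≤ t * (B * 4 ^ N * ((∫ x in annulus N n, ‖G x‖) + ε / c)) := by
    gcongr
    linarith
  have e4 : (2 : ℝ) ^ N * ∫ y in annulus N n, ‖u y - v y‖ ≤ 2 ^ N * (ε / c) := by gcongr
  have e5 : c * (ε / c) = ε := by field_simp
  rw [hc] at e5
  linarith

end Displacement

/-! ### Continuity of Φ_q -/

section Phi

/-- For q < 2 the factor `|t|^(q-2)` is singular at 0, so the function is rewritten with powers q -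
1 > 0 of the positive and negative parts. -/
lemma continuous_Phi {q : ℝ} (hq : 1 < q) : Continuous (Phi q) := by
  have : Phi q = fun t => (max t 0) ^ (q - 1) - (max (-t) 0) ^ (q - 1) := by
    ext1 t
    have h0 : q - 1 ≠ 0 := by linarith
    rcases lt_trichotomy t 0 with h | rfl | h
    · rw [Phi, abs_of_neg h, max_eq_right h.le, max_eq_left (by linarith), Real.zero_rpow h0,
        show q - 1 = (q - 2) + 1 by ring, Real.rpow_add_one (by linarith)]
      ring
    · simp [Phi]
    · rw [Phi, abs_of_pos h, max_eq_left h.le, max_eq_right (by linarith), Real.zero_rpow h0,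
        show q - 1 = (q - 2) + 1 by ring, Real.rpow_add_one h.ne']
      ring
  rw [this]
  have hq' : 0 ≤ q - 1 := by linarith
  exact ((continuous_id.max continuous_const).rpow_const fun _ => Or.inr hq').sub
    ((continuous_neg.max continuous_const).rpow_const fun _ => Or.inr hq')

lemma exists_Phi_bound {q : ℝ} (hq : 1 < q) (M : ℝ) :
    ∃ W : ℝ, 0 ≤ W ∧ ∀ a b : ℝ, |a| ≤ M → |b| ≤ M → |Phi q a - Phi q b| ≤ W := by
  obtain ⟨C, hC⟩ := (isCompact_Icc (a := -M) (b := M)).exists_bound_of_continuousOn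
    (continuous_Phi hq).continuousOn
  refine ⟨|C| + |C|, by positivity, fun a b ha hb => ?_⟩
  refine (abs_sub _ _).trans (add_le_add ?_ ?_)
  · exact (hC a (abs_le.1 ha)).trans (le_abs_self _)
  · exact (hC b (abs_le.1 hb)).trans (le_abs_self _)

/-- A modulus of continuity for `Φ_q` on bounded sets, in linearized form. -/
lemma exists_Phi_modulus {q : ℝ} (hq : 1 < q) (M : ℝ) {ε : ℝ} (hε : 0 < ε) :
    ∃ C : ℝ, 0 ≤ C ∧ ∀ a b : ℝ, |a| ≤ M → |b| ≤ M → |Phi q a - Phi q b| ≤ ε + C * |a - b| := by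
  obtain ⟨W, hW0, hW⟩ := exists_Phi_bound hq M
  obtain ⟨δ, hδ, h⟩ := Metric.uniformContinuousOn_iff.1
    ((isCompact_Icc (a := -M) (b := M)).uniformContinuousOn_of_continuous
      (continuous_Phi hq).continuousOn) ε hε
  -- Below δ uniform continuity suffices. Above δ the global oscillation bound satisfies W ≤ (W/δ)|a
  -- - b|.
  refine ⟨W / δ, by positivity, fun a b ha hb => ?_⟩
  by_cases hab : |a - b| < δ
  · have := (h a (abs_le.1 ha) b (abs_le.1 hb) hab).le
    rw [Real.dist_eq] at this
    have h2 : 0 ≤ W / δ * |a - b| := by positivity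
    linarith
  · push Not at hab
    refine (hW a b ha hb).trans ?_
    have : W ≤ W / δ * |a - b| := by
      rw [div_mul_eq_mul_div, le_div_iff₀ hδ]; gcongr
    linarith

end Phi

/-! ### One-sided first-order expansions -/

section Slope

/-- `F n t ≤ F₀ + t (a + o(1))` as `t → 0⁺` and then `n → ∞`. -/
def SlopeLE (F : ℕ → ℝ → ℝ) (F₀ a : ℝ) : Prop :=
  ∀ ε > 0, ∀ᶠ n in atTop, ∀ᶠ t in 𝓝[>] (0 : ℝ), F n t - F₀ ≤ t * (a + ε)

lemma SlopeLE.add {F G : ℕ → ℝ → ℝ} {F₀ G₀ a b : ℝ} (hF : SlopeLE F F₀ a) (hG : SlopeLE G G₀ b) :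
    SlopeLE (fun n t => F n t + G n t) (F₀ + G₀) (a + b) := by
  intro ε hε
  filter_upwards [hF (ε / 2) (by positivity), hG (ε / 2) (by positivity)] with n h1 h2
  filter_upwards [h1, h2] with t h3 h4
  linarith

/-- The slope of `F` is requested only for c ≠ 0: when γ or 1 - γ vanishes, convergence of the
corresponding pairing is not part of the weak formulation. -/
lemma SlopeLE.const_mul {F : ℕ → ℝ → ℝ} {F₀ a c : ℝ} (hc : 0 ≤ c) (hF : c ≠ 0 → SlopeLE F F₀ a) :
    SlopeLE (fun n t => c * F n t) (c * F₀) (c * a) := by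
  intro ε hε
  rcases hc.eq_or_lt with rfl | hc
  · refine Eventually.of_forall fun n => ?_
    filter_upwards [self_mem_nhdsWithin] with t (ht : 0 < t)
    simp only [zero_mul, sub_zero, zero_add]
    positivity
  · filter_upwards [hF hc.ne' (ε / c) (by positivity)] with n h1
    filter_upwards [h1] with t h3
    calc c * F n t - c * F₀ = c * (F n t - F₀) := by ring
      _ ≤ c * (t * (a + ε / c)) := by gcongr
      _ = t * (c * a + ε) := by field_simp

lemma SlopeLE.mono {F G : ℕ → ℝ → ℝ} {F₀ G₀ a b : ℝ} (hF : SlopeLE F F₀ a) (hab : a ≤ b)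
    (h : ∀ n, ∀ᶠ t in 𝓝[>] (0 : ℝ), G n t - G₀ ≤ F n t - F₀) : SlopeLE G G₀ b := by
  intro ε hε
  filter_upwards [hF ε hε] with n h1
  filter_upwards [h1, h n, self_mem_nhdsWithin] with t h2 h3 (ht : 0 < t)
  refine (h3.trans h2).trans ?_
  gcongr

/-- The weak formulation makes the sum of all terms constant in t; this converts that fact into the
Pohozaev inequality. -/
lemma SlopeLE.nonneg {a : ℝ} {F : ℕ → ℝ → ℝ} {F₀ : ℝ} (hF : SlopeLE F F₀ a)
    (h : ∀ n, ∀ᶠ t in 𝓝[>] (0 : ℝ), F n t = F₀) : 0 ≤ a := by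
  refine le_of_forall_pos_le_add fun ε hε => ?_
  obtain ⟨n, hn⟩ := (hF ε hε).exists
  obtain ⟨t, ⟨h1, h2⟩, ht : 0 < t⟩ := ((hn.and (h n)).and self_mem_nhdsWithin).exists
  rw [h2, sub_self] at h1
  exact nonneg_of_mul_nonneg_right h1 ht

/-- The right-hand side of the bound equals `F₀` at t = 0 and has derivative `-m F₀ + (m - LK) η n`
there. The second summand tends to 0 because L, K and m do not depend on n. -/
lemma slopeLE_of_bound {N : ℕ} {F : ℕ → ℝ → ℝ} {F₀ m K : ℝ} {η : ℕ → ℝ}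
    (hη : Tendsto η atTop (𝓝 0))
    (h : ∀ n t, Small N t →
      F n t ≤ (1 - t) ^ m * F₀ + ((1 - t * fieldLip N) ^ K - (1 - t) ^ m) * η n) :
    SlopeLE F F₀ (-m * F₀) := by
  intro ε hε
  set L := fieldLip N
  have hlim : Tendsto (fun n => (-L * K + m) * η n) atTop (𝓝 0) := by
    simpa using hη.const_mul (-L * K + m)
  filter_upwards [hlim.eventually_lt_const (half_pos hε)] with n hn
  set g : ℝ → ℝ := fun t => (1 - t) ^ m * F₀ + ((1 - t * L) ^ K - (1 - t) ^ m) * η n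
  have d1 : HasDerivAt (fun t : ℝ => (1 - t) ^ m) (-m) 0 := by
    have : HasDerivAt (fun t : ℝ => 1 - t) (-1) 0 := by
      simpa using (hasDerivAt_id (0 : ℝ)).const_sub 1
    simpa using this.rpow_const (p := m) (Or.inl (by norm_num))
  have d2 : HasDerivAt (fun t : ℝ => (1 - t * L) ^ K) (-L * K) 0 := by
    have : HasDerivAt (fun t : ℝ => 1 - t * L) (-L) 0 := by
      simpa using ((hasDerivAt_id (0 : ℝ)).mul_const L).const_sub 1
    simpa using this.rpow_const (p := K) (Or.inl (by norm_num))
  have dg : HasDerivAt g (-m * F₀ + (-L * K - -m) * η n) 0 :=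
    (d1.mul_const F₀).add ((d2.sub d1).mul_const (η n))
  have hs : Tendsto (slope g 0) (𝓝[>] 0) (𝓝 (-m * F₀ + (-L * K - -m) * η n)) :=
    (hasDerivAt_iff_tendsto_slope.1 dg).mono_left
      (nhdsWithin_mono _ fun x (hx : 0 < x) => hx.ne')
  have hlt : -m * F₀ + (-L * K - -m) * η n < -m * F₀ + ε := by
    have e : -L * K - -m = -L * K + m := by ring
    rw [e]
    linarith
  filter_upwards [hs.eventually_lt_const hlt, eventually_small N] with t h1 ht
  have h2 := h n t ht
  have g0 : g 0 = F₀ := by simp [g]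
  rw [slope_def_field, sub_zero, div_lt_iff₀ ht.pos, g0] at h1
  have h3 : F n t ≤ g t := h2
  linarith

end Slope

/-! ### The source remainder is o(t) -/

section Remainder

variable {N n : ℕ}

lemma exists_displacement_bound {v : E N → ℝ} (hv : ContDiff ℝ 1 v) (n : ℕ) :
    ∃ C : ℝ, 0 ≤ C ∧ ∀ t, Small N t → ∀ y ∈ annulus N n,
      ‖v ((deform N n t).toHomeo.symm y) - v y‖ ≤ C * t := by
  obtain ⟨B, hB0, hB⟩ := exists_norm_dilField_le N n
  obtain ⟨C, hC⟩ := (isCompact_closedBall (0 : E N) (2 * (n + 1) + B)).exists_bound_of_continuousOn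
    (f := fderiv ℝ v) (hv.continuous_fderiv one_ne_zero).continuousOn
  have hC0 : 0 ≤ C := (norm_nonneg _).trans (hC 0 (by simp; positivity))
  -- A point y of the annulus and its preimage x differ by at most tB, so both lie in one ball, on
  -- which the mean value inequality with the derivative bound C applies.
  refine ⟨C * B, by positivity, fun t ht y hy => ?_⟩
  set x := (deform N n t).toHomeo.symm y with hx
  have hxy : x - t • dilField n x = y := by
    rw [← deform_apply ht, hx, Homeomorph.apply_symm_apply]
  have hd : ‖x - y‖ ≤ t * B := by
    rw [← hxy, sub_sub_cancel, norm_smul, Real.norm_of_nonneg ht.pos.le]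
    have := ht.pos.le
    gcongr
    exact hB x
  have hyb : y ∈ Metric.closedBall (0 : E N) (2 * (n + 1) + B) := by
    rw [mem_closedBall_zero_iff]; linarith [hy.2]
  have hxb : x ∈ Metric.closedBall (0 : E N) (2 * (n + 1) + B) := by
    rw [mem_closedBall_zero_iff]
    have h1 := norm_le_norm_add_norm_sub' x y
    have h2 : t * B ≤ B := by nlinarith [ht.le_half]
    linarith [hy.2]
  have := (convex_closedBall (0 : E N) (2 * (n + 1) + B)).norm_image_sub_le_of_norm_fderiv_le
    (fun z _ => hv.differentiable one_ne_zero z) hC hyb hxb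
  refine this.trans ?_
  calc C * ‖x - y‖ ≤ C * (t * B) := by gcongr
    _ = C * B * t := by ring

/-- The error made in replacing `Φ_q(u)` by `Φ_q(u ∘ φ_t⁻¹)`. -/
def remainder (n : ℕ) (q α : ℝ) (u : E N → ℝ) (t : ℝ) (y : E N) : ℝ :=
  ‖y‖ ^ α * (|Phi q (u ((deform N n t).toHomeo.symm y)) - Phi q (u y)|
    * |u ((deform N n t).toHomeo.symm y) - u y|)

/-- The remainder is integrable and `o(t)` in `L¹`. -/
theorem remainder_isLittleO {u : E N → ℝ} {G : E N → E N} (hu : IsWeakGradient u G) {M : ℝ}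
    (hM : ∀ᵐ x, |u x| ≤ M) {q : ℝ} (hq : 1 < q) (α : ℝ) (n : ℕ) {ε : ℝ} (hε : 0 < ε) :
    ∀ᶠ t in 𝓝[>] (0 : ℝ), Integrable (remainder n q α u t) volume ∧
      ∫ y, remainder n q α u t y ≤ t * ε := by
  have hK := isCompact_annulus (N := N) n
  obtain ⟨B, hB0, hB⟩ := exists_norm_dilField_le N n
  obtain ⟨W, hW0, hW⟩ := exists_Phi_bound hq M
  obtain ⟨k, hk⟩ := hK.exists_bound_of_continuousOn (f := fun y : E N => ‖y‖ ^ α)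
    (fun y hy => (continuous_norm.continuousAt.rpow_const (Or.inl (norm_ne_zero_iff.2
      (fun h => zero_notMem_annulus n (h ▸ hy))))).continuousWithinAt)
  set k' := |k| with hk'
  have hk'0 : 0 ≤ k' := abs_nonneg k
  set A : ℝ := B * 4 ^ N with hA
  have hA0 : 0 ≤ A := by positivity
  -- The constants are chosen in a fixed order: ε₁ determines the smooth v, hence `Cv`; then ε₂
  -- determines `C₂`; finally t is taken small. Each choice contributes at most ε/3, and each `+ 1`
  -- avoids division by zero.
  set ε₁ : ℝ := ε / (3 * (k' * W * A + 1)) with hε₁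
  obtain ⟨v, hv, -, hvG⟩ := hu.exists_contDiff_approx hK (ε := ε₁) (by positivity)
  have hv1 : ContDiff ℝ 1 v := hv.of_le (by exact_mod_cast le_top)
  have hvw := isWeakGradient_gradient hv1
  obtain ⟨Cv, hCv0, hCv⟩ := exists_displacement_bound hv1 n
  set m := volume.real (annulus N n) with hm
  have hm0 : 0 ≤ m := measureReal_nonneg
  set ε₂ : ℝ := ε / (3 * (k' * Cv * m + 1)) with hε₂
  obtain ⟨C₂, hC₂0, hC₂⟩ := exists_Phi_modulus hq M (ε := ε₂) (by positivity)
  set g : ℝ := ∫ x in annulus N n, ‖G x‖ with hg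
  have hg0 : 0 ≤ g := integral_nonneg fun _ => norm_nonneg _
  have htsmall : ∀ᶠ t in 𝓝[>] (0 : ℝ), t < ε / (3 * (k' * Cv * C₂ * (A * g) + 1)) :=
    nhdsWithin_le_nhds (gt_mem_nhds (by positivity))
  filter_upwards [eventually_small N, htsmall] with t ht htε
  have ht0 := ht.pos
  set D := deform N n t with hD
  have hoff : ∀ y ∉ annulus N n, remainder n q α u t y = 0 := fun y hy => by
    rw [remainder, deform_symm_apply_of_notMem_annulus ht hy]; simp
  have hM' : ∀ᵐ y, |u (D.toHomeo.symm y)| ≤ M :=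
    D.isJacobian.quasiMeasurePreserving_symm.ae hM
  have hum := hu.1.aestronglyMeasurable
  have hum' := D.aestronglyMeasurable_comp_symm hum
  have hΦ := continuous_Phi hq
  have hmeas : AEStronglyMeasurable (remainder n q α u t) volume := by
    refine AEStronglyMeasurable.mul ?_ (AEStronglyMeasurable.mul ?_ ?_)
    · exact (measurable_norm.pow_const α).aestronglyMeasurable
    · exact ((hΦ.comp_aestronglyMeasurable hum').sub (hΦ.comp_aestronglyMeasurable hum)).norm
    · exact (hum'.sub hum).norm
  have iz := hu.sub hvw
  have i1 : IntegrableOn (fun y => ‖(u (D.toHomeo.symm y) - v (D.toHomeo.symm y)) - (u y - v y)‖)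
      (annulus N n) volume :=
    (((D.locallyIntegrable_comp_symm iz.1).sub iz.1).integrableOn_isCompact hK).norm
  have i2 : IntegrableOn (fun y => ‖u (D.toHomeo.symm y) - u y‖) (annulus N n) volume :=
    (((D.locallyIntegrable_comp_symm hu.1).sub hu.1).integrableOn_isCompact hK).norm
  have ic : IntegrableOn (fun _ : E N => ε₂) (annulus N n) volume :=
    integrableOn_const hK.measure_lt_top.ne
  have i3 : IntegrableOn (fun y => W * ‖(u (D.toHomeo.symm y) - v (D.toHomeo.symm y))
      - (u y - v y)‖) (annulus N n) volume := i1.const_mul W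
  have i4 : IntegrableOn (fun y => ε₂ + C₂ * ‖u (D.toHomeo.symm y) - u y‖)
      (annulus N n) volume := ic.add (i2.const_mul C₂)
  have i5 : IntegrableOn (fun y => W * ‖(u (D.toHomeo.symm y) - v (D.toHomeo.symm y))
      - (u y - v y)‖ + (Cv * t) * (ε₂ + C₂ * ‖u (D.toHomeo.symm y) - u y‖))
      (annulus N n) volume := i3.add (i4.const_mul _)
  have hpt : ∀ᵐ y, y ∈ annulus N n → remainder n q α u t y
      ≤ k' * (W * ‖(u (D.toHomeo.symm y) - v (D.toHomeo.symm y)) - (u y - v y)‖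
        + (Cv * t) * (ε₂ + C₂ * ‖u (D.toHomeo.symm y) - u y‖)) := by
    filter_upwards [hM, hM'] with y h1 h2 hy
    have b1 := hW _ _ h2 h1
    have b2 := hC₂ _ _ h2 h1
    have b3 := hCv t ht y hy
    have b4 : ‖y‖ ^ α ≤ k' := ((le_abs_self _).trans (hk y hy)).trans (le_abs_self _)
    -- The displacement is split into that of u - v, of size tε₁ in L¹, and that of v, of size t
    -- pointwise. The difference of the Φ_q values is bounded by W against the first part and by its
    -- modulus of continuity against the second.
    have b5 : |u (D.toHomeo.symm y) - u y|
        ≤ ‖(u (D.toHomeo.symm y) - v (D.toHomeo.symm y)) - (u y - v y)‖ + Cv * t := by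
      calc |u (D.toHomeo.symm y) - u y|
          = ‖((u (D.toHomeo.symm y) - v (D.toHomeo.symm y)) - (u y - v y))
            + (v (D.toHomeo.symm y) - v y)‖ := by rw [Real.norm_eq_abs]; congr 1; ring
        _ ≤ _ := (norm_add_le _ _).trans (by gcongr)
    rw [remainder]
    refine mul_le_mul b4 ?_ (by positivity) hk'0
    set w := |Phi q (u (D.toHomeo.symm y)) - Phi q (u y)| with hw
    have hw0 : 0 ≤ w := abs_nonneg _
    calc w * |u (D.toHomeo.symm y) - u y|
        ≤ w * (‖(u (D.toHomeo.symm y) - v (D.toHomeo.symm y)) - (u y - v y)‖ + Cv * t) := by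
          gcongr
      _ = w * ‖(u (D.toHomeo.symm y) - v (D.toHomeo.symm y)) - (u y - v y)‖ + (Cv * t) * w := by
          ring
      _ ≤ _ := by
          rw [Real.norm_eq_abs (u (D.toHomeo.symm y) - u y)]
          gcongr
  have hnn : ∀ y, 0 ≤ remainder n q α u t y := fun y => by
    unfold remainder; positivity
  have hintK : IntegrableOn (remainder n q α u t) (annulus N n) volume := by
    refine (i5.const_mul k').mono' hmeas.restrict ?_
    rw [ae_restrict_iff' hK.measurableSet]
    filter_upwards [hpt] with y h1 hy
    rw [Real.norm_of_nonneg (hnn y)]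
    exact h1 hy
  have hint : Integrable (remainder n q α u t) volume :=
    (integrableOn_iff_integrable_of_support_subset fun y hy => by
      by_contra hc; exact hy (hoff y hc)).1 hintK
  refine ⟨hint, ?_⟩
  have h1 : ∫ y, remainder n q α u t y = ∫ y in annulus N n, remainder n q α u t y :=
    (setIntegral_eq_integral_of_forall_compl_eq_zero hoff).symm
  have h2 := setIntegral_mono_ae_restrict hintK (i5.const_mul k')
    ((ae_restrict_iff' hK.measurableSet).2 hpt)
  rw [integral_const_mul, integral_add i3 (i4.const_mul _), integral_const_mul, integral_const_mul,
    integral_add ic (i2.const_mul C₂), integral_const_mul, setIntegral_const, smul_eq_mul] at h2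
  have h3 := setIntegral_deform_sub_le iz hB0 hB ht
  have h4 := setIntegral_deform_sub_le hu hB0 hB ht
  rw [h1]
  refine h2.trans ?_
  have h5 : ∫ y in annulus N n, ‖(u (D.toHomeo.symm y) - v (D.toHomeo.symm y)) - (u y - v y)‖
      ≤ t * (A * ε₁) := h3.trans (by gcongr)
  have f1 : k' * W * A * ε₁ ≤ ε / 3 := by
    rw [hε₁, mul_div_assoc', div_le_div_iff₀ (by positivity) (by positivity)]
    nlinarith
  have f2 : k' * Cv * m * ε₂ ≤ ε / 3 := by
    rw [hε₂, mul_div_assoc', div_le_div_iff₀ (by positivity) (by positivity)]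
    nlinarith
  have f3 : k' * Cv * C₂ * (A * g) * t ≤ ε / 3 := by
    have h0 : 0 ≤ k' * Cv * C₂ * (A * g) := by positivity
    refine (mul_le_mul_of_nonneg_left htε.le h0).trans ?_
    rw [mul_div_assoc', div_le_div_iff₀ (by positivity) (by positivity)]
    nlinarith
  calc _ ≤ k' * (W * (t * (A * ε₁)) + Cv * t * (m * ε₂ + C₂ * (t * (A * g)))) := by
        gcongr
    _ = t * (k' * W * A * ε₁ + k' * Cv * m * ε₂ + k' * Cv * C₂ * (A * g) * t) := by ring
    _ ≤ t * ε := by gcongr; linarith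

end Remainder

/-! ### First variation of a general energy -/

section EnergySlope

variable {α : Type*} [MeasurableSpace α] {μ : Measure α}

lemma tendsto_setIntegral_compl {e : α → ℝ} (he : Integrable e μ) {S : ℕ → Set α}
    (hS : ∀ n, MeasurableSet (S n)) (hev : ∀ᵐ x ∂μ, ∀ᶠ n in atTop, x ∈ S n) :
    Tendsto (fun n => ∫ x in (S n)ᶜ, e x ∂μ) atTop (𝓝 0) := by
  have h := tendsto_integral_of_dominated_convergence (μ := μ)
    (F := fun n => (S n)ᶜ.indicator e) (f := fun _ => 0) (fun x => ‖e x‖)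
    (fun n => he.aestronglyMeasurable.indicator (hS n).compl) he.norm
    (fun n => Eventually.of_forall fun x => norm_indicator_le_norm_self _ _) (by
      filter_upwards [hev] with x hx
      refine tendsto_const_nhds.congr' ?_
      filter_upwards [hx] with n hn
      rw [Set.indicator_of_notMem (by simpa using hn)])
  simpa only [integral_indicator (hS _).compl, integral_zero] using h

/-- First variation of an energy along the deformations. -/
theorem energy_slope {N : ℕ} {φ : ℕ → ℝ → α ≃ᵐ α} {J : ℕ → ℝ → α → ℝ≥0} {S : ℕ → Set α}
    (hJ : ∀ n t, IsJacobian μ (φ n t) (J n t)) (hS : ∀ n, MeasurableSet (S n))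
    (hev : ∀ᵐ x ∂μ, ∀ᶠ n in atTop, x ∈ S n) {e : α → ℝ} (he : Integrable e μ)
    (he0 : ∀ x, 0 ≤ e x) {e' : ℕ → ℝ → α → ℝ} {m K : ℝ}
    (hm : ∀ n t, AEStronglyMeasurable (fun x => (J n t x : ℝ) * e' n t (φ n t x)) μ)
    (hl : ∀ n t, Small N t → ∀ᵐ x ∂μ,
      (1 - t * fieldLip N) ^ K * e x ≤ J n t x * e' n t (φ n t x))
    (hk : ∀ n t, Small N t → ∀ᵐ x ∂μ,
      J n t x * e' n t (φ n t x) ≤ (1 - t * fieldLip N) ^ (-K) * e x)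
    (hκ : ∀ n t, Small N t → ∀ᵐ x ∂μ, x ∈ S n →
      J n t x * e' n t (φ n t x) = (1 - t) ^ m * e x) :
    (∀ n t, Small N t → Integrable (e' n t) μ) ∧
      SlopeLE (fun n t => ∫ x, e' n t x ∂μ) (∫ x, e x ∂μ) (-m * ∫ x, e x ∂μ) ∧
      SlopeLE (fun n t => -∫ x, e' n t x ∂μ) (-∫ x, e x ∂μ) (m * ∫ x, e x ∂μ) := by
  have hpos : ∀ t, Small N t → 0 ≤ 1 - t * fieldLip N := fun t ht => by linarith [ht.2]
  have key := fun n t (ht : Small N t) => (hJ n t).energy_bounds he he0 (hS n) (hm n t)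
    (Real.rpow_nonneg (hpos t ht) K) (hl n t ht) (hk n t ht) (hκ n t ht)
  have hη := tendsto_setIntegral_compl he hS hev
  refine ⟨fun n t ht => (key n t ht).1,
    slopeLE_of_bound (N := N) (K := -K) hη fun n t ht => (key n t ht).2.1, ?_⟩
  -- Negating the lower energy bound gives an upper bound of the same form, with the sign of `η`
  -- reversed.
  have := slopeLE_of_bound (N := N) (F := fun n t => -∫ x, e' n t x ∂μ) (F₀ := -∫ x, e x ∂μ)
    (m := m) (K := K) (η := fun n => -∫ x in (S n)ᶜ, e x ∂μ) (by simpa using hη.neg)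
    fun n t ht => by have := (key n t ht).2.2; linarith
  simpa using this

end EnergySlope

/-! ### First variation of the weighted, Gagliardo and Dirichlet energies -/

section Energies

variable {N : ℕ}

/-- The exponent |c| covers both monotonicities of the power. The case r = 0 forces s = 0 and is
treated apart, since real powers of 0 with negative exponents are conventional. -/
lemma rpow_bounds {a r s : ℝ} (ha : 0 < a) (ha1 : a ≤ 1) (hr : 0 ≤ r) (h1 : a * r ≤ s)
    (h2 : s ≤ a⁻¹ * r) (c : ℝ) : a ^ |c| * r ^ c ≤ s ^ c ∧ s ^ c ≤ a ^ (-|c|) * r ^ c := by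
  have hai : 0 < a⁻¹ := inv_pos.2 ha
  rcases hr.eq_or_lt with rfl | hr
  · rw [mul_zero] at h1 h2
    obtain rfl : s = 0 := le_antisymm h2 h1
    have h0 : (0 : ℝ) ≤ 0 ^ c := Real.rpow_nonneg le_rfl c
    exact ⟨mul_le_of_le_one_left h0 (Real.rpow_le_one ha.le ha1 (abs_nonneg c)),
      le_mul_of_one_le_left h0 (Real.one_le_rpow_of_pos_of_le_one_of_nonpos ha ha1
        (neg_nonpos.2 (abs_nonneg c)))⟩
  · have har : 0 < a * r := by positivity
    have hs : 0 < s := har.trans_le h1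
    have e1 : (a * r) ^ c = a ^ c * r ^ c := Real.mul_rpow ha.le hr.le
    have e2 : (a⁻¹ * r) ^ c = a ^ (-c) * r ^ c := by
      rw [Real.mul_rpow hai.le hr.le, Real.inv_rpow ha.le, Real.rpow_neg ha.le]
    rcases le_total 0 c with hc | hc
    · rw [abs_of_nonneg hc, ← e1, ← e2]
      exact ⟨Real.rpow_le_rpow har.le h1 hc, Real.rpow_le_rpow hs.le h2 hc⟩
    · rw [abs_of_nonpos hc, neg_neg, ← e1, ← e2]
      exact ⟨Real.rpow_le_rpow_of_nonpos hs h2 hc, Real.rpow_le_rpow_of_nonpos har h1 hc⟩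

instance nontrivial_E [NeZero N] : Nontrivial (E N) :=
  ⟨⟨EuclideanSpace.single 0 1, 0, by simp⟩⟩

lemma ae_eventually_mem_core [NeZero N] :
    ∀ᵐ x : E N, ∀ᶠ n in atTop, x ∈ core N n := by
  filter_upwards [Measure.ae_ne volume (0 : E N)] with x hx
  exact eventually_mem_core hx

lemma jac_pow_bounds {n : ℕ} {t : ℝ} (h : Small N t) (x : E N) :
    (1 - t * fieldLip N) ^ (N : ℝ) ≤ (deform N n t).jac x ∧
      ((deform N n t).jac x : ℝ) ≤ (1 - t * fieldLip N) ^ (-(N : ℝ)) := by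
  have h0 : 0 ≤ 1 - t * fieldLip N := by linarith [h.2]
  have := (deform N n t).jac_mem x
  rw [deform_a h] at this
  rw [Real.rpow_neg h0, Real.rpow_natCast, ← inv_pow]
  exact this

/-- Combines two factorwise bounds by powers of `b`. -/
lemma rpow_mul_bounds {b j f f' A B : ℝ} (hb : 0 < b) (hf : 0 ≤ f)
    (h1 : b ^ A ≤ j) (h2 : j ≤ b ^ (-A)) (h3 : b ^ B * f ≤ f') (h4 : f' ≤ b ^ (-B) * f) :
    b ^ (A + B) * f ≤ j * f' ∧ j * f' ≤ b ^ (-(A + B)) * f := by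
  have hA := Real.rpow_pos_of_pos hb A
  have hB := Real.rpow_pos_of_pos hb B
  have hB' := Real.rpow_pos_of_pos hb (-B)
  have hj : 0 ≤ j := hA.le.trans h1
  constructor
  · rw [Real.rpow_add hb, mul_assoc]
    exact mul_le_mul h1 h3 (by positivity) hj
  · rw [neg_add, Real.rpow_add hb, mul_assoc]
    exact (mul_le_mul_of_nonneg_left h4 hj).trans
      (mul_le_mul_of_nonneg_right h2 (by positivity))

/-- First variation of the weighted energy `∫ |x|^α |u|^p`. -/
theorem weighted_slope [NeZero N] {u : E N → ℝ} (hu : AEStronglyMeasurable u volume) {α p : ℝ}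
    (he : Integrable (fun x : E N => ‖x‖ ^ α * |u x| ^ p) volume) :
    (∀ n t, Small N t → Integrable
      (fun y : E N => ‖y‖ ^ α * |u ((deform N n t).toHomeo.symm y)| ^ p) volume) ∧
    SlopeLE (fun n t => ∫ y : E N, ‖y‖ ^ α * |u ((deform N n t).toHomeo.symm y)| ^ p)
      (∫ x : E N, ‖x‖ ^ α * |u x| ^ p) (-(N + α) * ∫ x : E N, ‖x‖ ^ α * |u x| ^ p) ∧
    SlopeLE (fun n t => -∫ y : E N, ‖y‖ ^ α * |u ((deform N n t).toHomeo.symm y)| ^ p)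
      (-∫ x : E N, ‖x‖ ^ α * |u x| ^ p) ((N + α) * ∫ x : E N, ‖x‖ ^ α * |u x| ^ p) := by
  have hb : ∀ n t, Small N t → ∀ x : E N,
      (1 - t * fieldLip N) ^ (N + |α|) * (‖x‖ ^ α * |u x| ^ p)
        ≤ (deform N n t).jac x * (‖(deform N n t).toHomeo x‖ ^ α * |u x| ^ p) ∧
      (deform N n t).jac x * (‖(deform N n t).toHomeo x‖ ^ α * |u x| ^ p)
        ≤ (1 - t * fieldLip N) ^ (-(N + |α|)) * (‖x‖ ^ α * |u x| ^ p) := by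
    intro n t ht x
    have h0 : 0 < 1 - t * fieldLip N := by linarith [ht.2]
    have hJ := jac_pow_bounds (n := n) ht x
    have hlo := (deform N n t).lower x 0
    have hup := (deform N n t).upper x 0
    rw [(deform N n t).map_zero, sub_zero, sub_zero, deform_a ht] at hlo hup
    have hw := rpow_bounds h0 (by nlinarith [ht.1, fieldLip_pos (N := N)]) (norm_nonneg x)
      hlo hup α
    have := rpow_mul_bounds h0 (Real.rpow_nonneg (norm_nonneg x) α) hJ.1 hJ.2 hw.1 hw.2
    have hup0 : 0 ≤ |u x| ^ p := by positivity
    constructor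
    · rw [← mul_assoc, ← mul_assoc]
      exact mul_le_mul_of_nonneg_right this.1 hup0
    · rw [← mul_assoc, ← mul_assoc]
      exact mul_le_mul_of_nonneg_right this.2 hup0
  refine energy_slope (N := N) (K := N + |α|) (S := core N)
    (φ := fun n t => (deform N n t).toHomeo.toMeasurableEquiv)
    (J := fun n t => (deform N n t).jac)
    (e' := fun n t y => ‖y‖ ^ α * |u ((deform N n t).toHomeo.symm y)| ^ p)
    (fun n t => (deform N n t).isJacobian) (fun n => (isOpen_core n).measurableSet)
    ae_eventually_mem_core he (fun x => by positivity) ?_ ?_ ?_ ?_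
  · intro n t
    simp only [Homeomorph.toMeasurableEquiv_coe, Homeomorph.symm_apply_apply]
    refine AEStronglyMeasurable.mul
      (NNReal.continuous_coe.comp (deform N n t).continuous_jac).aestronglyMeasurable
      (AEStronglyMeasurable.mul ?_ ?_)
    · exact ((deform N n t).toHomeo.continuous.norm.measurable.pow_const α).aestronglyMeasurable
    · exact (hu.norm.aemeasurable.pow_const p).aestronglyMeasurable
  · intro n t ht
    simp only [Homeomorph.toMeasurableEquiv_coe, Homeomorph.symm_apply_apply]
    exact Eventually.of_forall fun x => (hb n t ht x).1
  · intro n t ht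
    simp only [Homeomorph.toMeasurableEquiv_coe, Homeomorph.symm_apply_apply]
    exact Eventually.of_forall fun x => (hb n t ht x).2
  · intro n t ht
    simp only [Homeomorph.toMeasurableEquiv_coe, Homeomorph.symm_apply_apply]
    refine Eventually.of_forall fun x hx => ?_
    -- On the core the Jacobian gives `(1 - t)^N` and the weight `(1 - t)^α`.
    have h1 : 0 < 1 - t := by linarith [ht.le_half]
    rw [jac_deform_of_mem_core ht hx, deform_apply_of_mem_core ht hx, norm_smul,
      Real.norm_of_nonneg h1.le, Real.mul_rpow h1.le (norm_nonneg x), Real.rpow_add h1,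
      Real.rpow_natCast]
    ring

/-- First variation of the Gagliardo energy. -/
theorem gagliardo_slope [NeZero N] {u : E N → ℝ} (hu : AEStronglyMeasurable u volume) {p d : ℝ}
    (he : Integrable (fun z : E N × E N => |u z.1 - u z.2| ^ p / ‖z.1 - z.2‖ ^ d)
      (volume.prod volume)) :
    (∀ n t, Small N t → Integrable (fun z : E N × E N =>
      |u ((deform N n t).toHomeo.symm z.1) - u ((deform N n t).toHomeo.symm z.2)| ^ p
        / ‖z.1 - z.2‖ ^ d) (volume.prod volume)) ∧
    SlopeLE (fun n t => ∫ z : E N × E N,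
      |u ((deform N n t).toHomeo.symm z.1) - u ((deform N n t).toHomeo.symm z.2)| ^ p
        / ‖z.1 - z.2‖ ^ d ∂(volume.prod volume))
      (∫ z : E N × E N, |u z.1 - u z.2| ^ p / ‖z.1 - z.2‖ ^ d ∂(volume.prod volume))
      (-(2 * N - d) *
        ∫ z : E N × E N, |u z.1 - u z.2| ^ p / ‖z.1 - z.2‖ ^ d ∂(volume.prod volume)) := by
  have hdiv : ∀ a b : ℝ, 0 ≤ b → a / b ^ d = a * b ^ (-d) := fun a b hb => by
    rw [Real.rpow_neg hb, div_eq_mul_inv]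
  have hb : ∀ n t, Small N t → ∀ z : E N × E N,
      (1 - t * fieldLip N) ^ (2 * N + |d|) * (|u z.1 - u z.2| ^ p / ‖z.1 - z.2‖ ^ d)
        ≤ ((deform N n t).jac z.1 * (deform N n t).jac z.2) *
          (|u z.1 - u z.2| ^ p
            / ‖(deform N n t).toHomeo z.1 - (deform N n t).toHomeo z.2‖ ^ d) ∧
      ((deform N n t).jac z.1 * (deform N n t).jac z.2) *
          (|u z.1 - u z.2| ^ p
            / ‖(deform N n t).toHomeo z.1 - (deform N n t).toHomeo z.2‖ ^ d)
        ≤ (1 - t * fieldLip N) ^ (-(2 * N + |d|))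
          * (|u z.1 - u z.2| ^ p / ‖z.1 - z.2‖ ^ d) := by
    intro n t ht z
    have h0 : 0 < 1 - t * fieldLip N := by linarith [ht.2]
    have hJ := jac_pow_bounds (n := n) ht z.1
    have hJ' := jac_pow_bounds (n := n) ht z.2
    have hlo := (deform N n t).lower z.1 z.2
    have hup := (deform N n t).upper z.1 z.2
    rw [deform_a ht] at hlo hup
    have hw := rpow_bounds h0 (by nlinarith [ht.1, fieldLip_pos (N := N)]) (norm_nonneg _)
      hlo hup (-d)
    rw [abs_neg] at hw
    -- The two Jacobians contribute the exponent 2N, the kernel the exponent |d|.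
    have hJJ := rpow_mul_bounds h0 zero_le_one hJ.1 hJ.2
      ((mul_one _).trans_le hJ'.1) (hJ'.2.trans_eq (mul_one _).symm)
    rw [mul_one, mul_one] at hJJ
    have := rpow_mul_bounds h0 (Real.rpow_nonneg (norm_nonneg (z.1 - z.2)) (-d))
      hJJ.1 hJJ.2 hw.1 hw.2
    have hup0 : 0 ≤ |u z.1 - u z.2| ^ p := by positivity
    rw [← two_mul] at this
    rw [hdiv _ _ (norm_nonneg _), hdiv _ _ (norm_nonneg _)]
    constructor
    · calc _ = (1 - t * fieldLip N) ^ (2 * N + |d|) * ‖z.1 - z.2‖ ^ (-d)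
            * |u z.1 - u z.2| ^ p := by ring
        _ ≤ _ := mul_le_mul_of_nonneg_right this.1 hup0
        _ = _ := by ring
    · calc _ = _ := by ring
        _ ≤ _ := mul_le_mul_of_nonneg_right this.2 hup0
        _ = _ := by ring
  have hev : ∀ᵐ z : E N × E N ∂(volume.prod volume), ∀ᶠ n in atTop,
      z ∈ core N n ×ˢ core N n := by
    filter_upwards [Measure.quasiMeasurePreserving_fst.ae (ae_eventually_mem_core (N := N)),
      Measure.quasiMeasurePreserving_snd.ae (ae_eventually_mem_core (N := N))] with z h1 h2
    filter_upwards [h1, h2] with n h3 h4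
    exact ⟨h3, h4⟩
  have happ : ∀ n t (z : E N × E N), ((deform N n t).toHomeo.toMeasurableEquiv.prodCongr
      (deform N n t).toHomeo.toMeasurableEquiv) z
      = ((deform N n t).toHomeo z.1, (deform N n t).toHomeo z.2) := fun _ _ _ => rfl
  have := energy_slope (N := N) (K := 2 * N + |d|) (m := 2 * N - d)
    (S := fun n => core N n ×ˢ core N n)
    (φ := fun n t => (deform N n t).toHomeo.toMeasurableEquiv.prodCongr
      (deform N n t).toHomeo.toMeasurableEquiv)
    (J := fun n t z => (deform N n t).jac z.1 * (deform N n t).jac z.2)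
    (e' := fun n t z =>
      |u ((deform N n t).toHomeo.symm z.1) - u ((deform N n t).toHomeo.symm z.2)| ^ p
        / ‖z.1 - z.2‖ ^ d)
    (fun n t => (deform N n t).isJacobian.prod)
    (fun n => (isOpen_core n).measurableSet.prod (isOpen_core n).measurableSet)
    hev he (fun x => by positivity) ?_ ?_ ?_ ?_
  · exact ⟨this.1, this.2.1⟩
  · intro n t
    simp only [happ, Homeomorph.symm_apply_apply, NNReal.coe_mul]
    have hJc := NNReal.continuous_coe.comp (deform N n t).continuous_jac
    have hφ := (deform N n t).toHomeo.continuous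
    refine AEStronglyMeasurable.mul
      ((hJc.comp continuous_fst).mul (hJc.comp continuous_snd)).aestronglyMeasurable
      (AEMeasurable.aestronglyMeasurable (AEMeasurable.div ?_ ?_))
    · exact ((hu.comp_fst.sub hu.comp_snd).norm.aemeasurable).pow_const p
    · exact (((hφ.comp continuous_fst).sub (hφ.comp continuous_snd)).norm.measurable.pow_const
        d).aemeasurable
  · intro n t ht
    simp only [happ, Homeomorph.symm_apply_apply, NNReal.coe_mul]
    exact Eventually.of_forall fun x => (hb n t ht x).1
  · intro n t ht
    simp only [happ, Homeomorph.symm_apply_apply, NNReal.coe_mul]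
    exact Eventually.of_forall fun x => (hb n t ht x).2
  · intro n t ht
    simp only [happ, Homeomorph.symm_apply_apply, NNReal.coe_mul]
    refine Eventually.of_forall fun z hz => ?_
    have h1 : 0 < 1 - t := by linarith [ht.le_half]
    rw [jac_deform_of_mem_core ht hz.1, jac_deform_of_mem_core ht hz.2,
      deform_apply_of_mem_core ht hz.1, deform_apply_of_mem_core ht hz.2, ← smul_sub, norm_smul,
      Real.norm_of_nonneg h1.le, hdiv _ _ (by positivity), hdiv _ _ (norm_nonneg _),
      Real.mul_rpow h1.le (norm_nonneg _), sub_eq_add_neg (2 * (N : ℝ)) d, two_mul,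
      Real.rpow_add h1, Real.rpow_add h1, Real.rpow_natCast]
    ring

lemma norm_pullGrad_of_mem_core {n : ℕ} {t : ℝ} (h : Small N t) (G : E N → E N) {x : E N}
    (hx : x ∈ core N n) :
    (1 - t) * ‖(deform N n t).pullGrad G ((deform N n t).toHomeo x)‖ = ‖G x‖ := by
  have h1 : 0 ≤ 1 - t := by linarith [h.le_half]
  have := (deform N n t).adjoint_pullGrad G x
  rw [fderiv_deform_of_mem_core h hx] at this
  rw [← this]
  have h2 : ContinuousLinearMap.adjoint ((1 - t) • ContinuousLinearMap.id ℝ (E N))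
      = (1 - t) • ContinuousLinearMap.id ℝ (E N) := by
    refine ((ContinuousLinearMap.eq_adjoint_iff _ _).2 fun x y => ?_).symm
    simp [inner_smul_left, inner_smul_right]
  rw [h2]
  simp [norm_smul, abs_of_nonneg h1]

/-- First variation of the Dirichlet energy `∫ |G|^p`. -/
theorem dirichlet_slope [NeZero N] {G : E N → E N} (hG : AEStronglyMeasurable G volume) {p : ℝ}
    (hp : 0 ≤ p) (he : Integrable (fun x : E N => ‖G x‖ ^ p) volume) :
    (∀ n t, Small N t → Integrable
      (fun y : E N => ‖(deform N n t).pullGrad G y‖ ^ p) volume) ∧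
    SlopeLE (fun n t => ∫ y : E N, ‖(deform N n t).pullGrad G y‖ ^ p)
      (∫ x : E N, ‖G x‖ ^ p) (-(N - p) * ∫ x : E N, ‖G x‖ ^ p) := by
  have hb : ∀ n t, Small N t → ∀ x : E N,
      (1 - t * fieldLip N) ^ (N + p) * ‖G x‖ ^ p
        ≤ (deform N n t).jac x * ‖(deform N n t).pullGrad G ((deform N n t).toHomeo x)‖ ^ p ∧
      (deform N n t).jac x * ‖(deform N n t).pullGrad G ((deform N n t).toHomeo x)‖ ^ p
        ≤ (1 - t * fieldLip N) ^ (-(N + p)) * ‖G x‖ ^ p := by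
    intro n t ht x
    have h0 : 0 < 1 - t * fieldLip N := by linarith [ht.2]
    have hJ := jac_pow_bounds (n := n) ht x
    have hlo := (deform N n t).le_norm_pullGrad G x
    have hup := (deform N n t).norm_pullGrad_le G ((deform N n t).toHomeo x)
    rw [Homeomorph.symm_apply_apply] at hup
    rw [deform_a ht] at hlo hup
    have hw := rpow_bounds h0 (by nlinarith [ht.1, fieldLip_pos (N := N)]) (norm_nonneg _)
      hlo hup p
    rw [abs_of_nonneg hp] at hw
    exact rpow_mul_bounds h0 (Real.rpow_nonneg (norm_nonneg (G x)) p) hJ.1 hJ.2 hw.1 hw.2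
  have := energy_slope (N := N) (K := N + p) (m := N - p) (S := core N)
    (φ := fun n t => (deform N n t).toHomeo.toMeasurableEquiv)
    (J := fun n t => (deform N n t).jac)
    (e' := fun n t y => ‖(deform N n t).pullGrad G y‖ ^ p)
    (fun n t => (deform N n t).isJacobian) (fun n => (isOpen_core n).measurableSet)
    ae_eventually_mem_core he (fun x => by positivity) ?_ ?_ ?_ ?_
  · exact ⟨this.1, this.2.1⟩
  · intro n t
    simp only [Homeomorph.toMeasurableEquiv_coe]
    refine AEStronglyMeasurable.mul
      (NNReal.continuous_coe.comp (deform N n t).continuous_jac).aestronglyMeasurable ?_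
    have h1 := ((deform N n t).aestronglyMeasurable_pullGrad hG).comp_quasiMeasurePreserving
      (deform N n t).isJacobian.quasiMeasurePreserving
    exact (h1.norm.aemeasurable.pow_const p).aestronglyMeasurable
  · intro n t ht
    exact Eventually.of_forall fun x => (hb n t ht x).1
  · intro n t ht
    exact Eventually.of_forall fun x => (hb n t ht x).2
  · intro n t ht
    simp only [Homeomorph.toMeasurableEquiv_coe]
    refine Eventually.of_forall fun x hx => ?_
    -- On the core the Jacobian gives `(1 - t)^N`, and the gradient is divided by 1 - t.
    have h1 : 0 < 1 - t := by linarith [ht.le_half]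
    rw [jac_deform_of_mem_core ht hx, ← norm_pullGrad_of_mem_core ht G hx,
      Real.mul_rpow h1.le (norm_nonneg _), Real.rpow_sub h1, Real.rpow_natCast]
    have := Real.rpow_pos_of_pos h1 p
    field_simp

end Energies

/-! ### Convexity inequalities for the p-th power -/

section Convexity

variable {N : ℕ} {p : ℝ}

lemma young_rpow (hp : 1 < p) {a b : ℝ} (ha : 0 ≤ a) (hb : 0 ≤ b) :
    a ^ (p - 1) * b ≤ (p - 1) / p * a ^ p + b ^ p / p := by
  have hc : p.HolderConjugate (Real.conjExponent p) := Real.HolderConjugate.conjExponent hp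
  have h := Real.young_inequality_of_nonneg hb (Real.rpow_nonneg ha (p - 1)) hc
  have hp0 : p - 1 ≠ 0 := by linarith
  rw [← Real.rpow_mul ha, Real.conjExponent, mul_div_cancel₀ p hp0] at h
  rw [mul_comm]
  refine h.trans (le_of_eq ?_)
  field_simp
  ring

lemma rpow_sub_two_mul_sq (hp : 1 < p) {a : ℝ} (ha : 0 ≤ a) : a ^ (p - 2) * a ^ 2 = a ^ p := by
  rcases ha.eq_or_lt with rfl | ha
  · rw [Real.zero_rpow (by linarith : p ≠ 0)]; ring
  · rw [← Real.rpow_natCast a 2, ← Real.rpow_add ha]; norm_num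

lemma rpow_sub_two_mul (hp : 1 < p) {a : ℝ} (ha : 0 ≤ a) : a ^ (p - 2) * a = a ^ (p - 1) := by
  rcases ha.eq_or_lt with rfl | ha
  · rw [Real.zero_rpow (by linarith : p - 1 ≠ 0)]; ring
  · rw [← Real.rpow_add_one ha.ne']; congr 1; ring

lemma Phi_mul_self (hp : 1 < p) (a : ℝ) : Phi p a * a = |a| ^ p := by
  rw [Phi, ← rpow_sub_two_mul_sq hp (abs_nonneg a), sq_abs]; ring

lemma inner_PhiVec_self (hp : 1 < p) (ξ : E N) : inner ℝ (PhiVec p ξ) ξ = ‖ξ‖ ^ p := by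
  rw [PhiVec, real_inner_smul_left, real_inner_self_eq_norm_sq,
    rpow_sub_two_mul_sq hp (norm_nonneg ξ)]

/-- This is the supporting hyperplane inequality for the convex function `‖·‖^p / p`, whose gradient
at ξ is `PhiVec p ξ`. It follows from Cauchy–Schwarz and Young. -/
lemma inner_PhiVec_sub_le (hp : 1 < p) (ξ ζ : E N) :
    inner ℝ (PhiVec p ξ) ζ - inner ℝ (PhiVec p ξ) ξ ≤ (‖ζ‖ ^ p - ‖ξ‖ ^ p) / p := by
  have hp0 : 0 < p := by linarith
  have h1 : inner ℝ (PhiVec p ξ) ζ ≤ ‖ξ‖ ^ (p - 1) * ‖ζ‖ := by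
    refine (real_inner_le_norm _ _).trans (le_of_eq ?_)
    rw [PhiVec, norm_smul, Real.norm_of_nonneg (by positivity),
      rpow_sub_two_mul hp (norm_nonneg ξ)]
  have h2 := young_rpow hp (norm_nonneg ξ) (norm_nonneg ζ)
  rw [inner_PhiVec_self hp]
  have h3 : (p - 1) / p * ‖ξ‖ ^ p + ‖ζ‖ ^ p / p - ‖ξ‖ ^ p = (‖ζ‖ ^ p - ‖ξ‖ ^ p) / p := by
    field_simp; ring
  linarith

lemma Phi_mul_sub_le (hp : 1 < p) (a b : ℝ) :
    Phi p a * b - Phi p a * a ≤ (|b| ^ p - |a| ^ p) / p := by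
  have hp0 : 0 < p := by linarith
  have h1 : Phi p a * b ≤ |a| ^ (p - 1) * |b| := by
    refine (le_abs_self _).trans (le_of_eq ?_)
    rw [Phi, abs_mul, abs_mul, abs_of_nonneg (by positivity : 0 ≤ |a| ^ (p - 2)),
      rpow_sub_two_mul hp (abs_nonneg a)]
  have h2 := young_rpow hp (abs_nonneg a) (abs_nonneg b)
  rw [Phi_mul_self hp]
  have h3 : (p - 1) / p * |a| ^ p + |b| ^ p / p - |a| ^ p = (|b| ^ p - |a| ^ p) / p := by
    field_simp; ring
  linarith

/-- If increments of `g` are dominated by those of an energy divided by `p`, so is the slope. -/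
lemma SlopeLE.of_convex {α : Type*} [MeasurableSpace α] {μ : Measure α} {N : ℕ}
    {e g₀ : α → ℝ} {e' g : ℕ → ℝ → α → ℝ} {a : ℝ} (hp : 0 < p) (he : Integrable e μ)
    (he' : ∀ n t, Small N t → Integrable (e' n t) μ)
    (hs : SlopeLE (fun n t => ∫ x, e' n t x ∂μ) (∫ x, e x ∂μ) a) (hg₀ : Integrable g₀ μ)
    (hg : ∀ n t, Small N t → Integrable (g n t) μ)
    (h : ∀ n t, Small N t → ∀ᵐ x ∂μ, g n t x - g₀ x ≤ (e' n t x - e x) / p) :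
    SlopeLE (fun n t => ∫ x, g n t x ∂μ) (∫ x, g₀ x ∂μ) (a / p) := by
  refine (SlopeLE.const_mul (c := 1 / p) (by positivity) fun _ => hs).mono (le_of_eq (by ring))
    fun n => ?_
  filter_upwards [eventually_small N] with t ht
  have h1 := integral_mono_ae ((hg n t ht).sub hg₀) (((he' n t ht).sub he).div_const p) (h n t ht)
  rw [integral_div] at h1
  simp only [Pi.sub_apply] at h1
  rw [integral_sub (hg n t ht) hg₀, integral_sub (he' n t ht) he] at h1
  refine h1.trans (le_of_eq ?_)
  ring

end Convexity

/-! ### The transported solution and the slopes of its pairings -/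

section Deformed

variable {N : ℕ}

/-- The function `u` transported by the deformation with parameters `n` and `t`. -/
def transport (u : E N → ℝ) (n : ℕ) (t : ℝ) (y : E N) : ℝ :=
  u ((deform N n t).toHomeo.symm y)

lemma isRadial_transport {u : E N → ℝ} (hu : IsRadial u) (n : ℕ) (t : ℝ) :
    IsRadial (transport u n t) := by
  classical
  obtain ⟨g, hg⟩ := hu
  set D := deform N n t with hD
  -- The norm of the preimage depends only on the norm of the point, so any representative of the
  -- sphere of radius r defines the profile; for r not attained as a norm the value is immaterial.
  refine ⟨fun r => if h : ∃ y : E N, ‖y‖ = r then g ‖D.toHomeo.symm h.choose‖ else 0, ?_⟩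
  filter_upwards [D.isJacobian.quasiMeasurePreserving_symm.ae hg] with y hy
  have hex : ∃ z : E N, ‖z‖ = ‖y‖ := ⟨y, rfl⟩
  simp only [dif_pos hex]
  rw [D.radial _ _ hex.choose_spec]
  exact hy

lemma integrable_rpow_of_memLp {G : E N → E N} {p : ℝ} (hp : 1 < p)
    (h : MemLp G (ENNReal.ofReal p) volume) : Integrable (fun x => ‖G x‖ ^ p) volume := by
  have := h.integrable_norm_rpow (by simp; linarith) (by simp)
  rwa [ENNReal.toReal_ofReal (by linarith)] at this

lemma memLp_of_integrable_rpow {G : E N → E N} {p : ℝ} (hp : 1 < p)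
    (hG : AEStronglyMeasurable G volume) (h : Integrable (fun x => ‖G x‖ ^ p) volume) :
    MemLp G (ENNReal.ofReal p) volume := by
  refine (integrable_norm_rpow_iff hG (by simp; linarith) (by simp)).1 ?_
  rwa [ENNReal.toReal_ofReal (by linarith)]

lemma memW_transport [NeZero N] {u : E N → ℝ} {s p β : ℝ} (hp : 1 < p)
    (hu : MemW s p β u) {n : ℕ} {t : ℝ} (ht : Small N t) : MemW s p β (transport u n t) := by
  obtain ⟨⟨hm, hw⟩, hf⟩ := hu
  refine ⟨⟨(deform N n t).aestronglyMeasurable_comp_symm hm, (weighted_slope hm hw).1 n t ht⟩, ?_⟩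
  unfold FiniteSeminorm at hf ⊢
  split_ifs at hf ⊢ with hs
  · obtain ⟨h1, h2⟩ := hf
    obtain ⟨h3, h4⟩ := (deform N n t).weakGrad_comp_symm h1
    refine ⟨h3, MemLp.ae_eq h4.symm ?_⟩
    exact memLp_of_integrable_rpow hp
      ((deform N n t).aestronglyMeasurable_pullGrad h2.aestronglyMeasurable)
      ((dirichlet_slope h2.aestronglyMeasurable (by linarith)
        (integrable_rpow_of_memLp hp h2)).1 n t ht)
  · exact (gagliardo_slope hm hf).1 n t ht

lemma memCalW_transport [NeZero N] {u : E N → ℝ} {γ s p β : ℝ} (hp : 1 < p)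
    (hu : MemCalW γ s p β u) {n : ℕ} {t : ℝ} (ht : Small N t) :
    MemCalW γ s p β (transport u n t) :=
  ⟨memW_transport hp hu.1 ht, isRadial_transport hu.2 n t⟩

lemma local_slope [NeZero N] {u : E N → ℝ} {p : ℝ} (hp : 1 < p) (hw : HasWeakGradient u)
    (hLp : MemLp (weakGrad u) (ENNReal.ofReal p) volume)
    (hut : ∀ n t, Small N t → Integrable (localIntegrand p u (transport u n t)) volume) :
    SlopeLE (fun n t => ∫ x, localIntegrand p u (transport u n t) x)
      (∫ x, localIntegrand p u u x) (-((N - p) / p) * ∫ x, localIntegrand p u u x) := by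
  have he := integrable_rpow_of_memLp hp hLp
  have hself : localIntegrand p u u = fun x => ‖weakGrad u x‖ ^ p := by
    ext1 x; exact inner_PhiVec_self hp _
  have hd := dirichlet_slope hLp.aestronglyMeasurable (by linarith) he
  have := SlopeLE.of_convex (N := N) (p := p) (g₀ := localIntegrand p u u) (by linarith) he
    hd.1 hd.2 (by rw [hself]; exact he) hut fun n t ht => by
      filter_upwards [((deform N n t).weakGrad_comp_symm hw).2] with x hx
      have h1 := inner_PhiVec_sub_le hp (weakGrad u x) (weakGrad (transport u n t) x)
      have h2 : weakGrad (transport u n t) x = (deform N n t).pullGrad (weakGrad u) x := hx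
      rw [← h2]
      exact h1
  refine this.mono (le_of_eq ?_) fun n => Eventually.of_forall fun t => le_rfl
  rw [hself]
  ring

/-- Scalar convexity applied to the increments reduces the pairing to the Gagliardo energy with d =
N + sp, for which 2N - d = N - sp. -/
lemma nonlocal_slope [NeZero N] {u : E N → ℝ} {s p : ℝ} (hp : 1 < p)
    (hm : AEStronglyMeasurable u volume)
    (hu : Integrable (nonlocalIntegrand s p u u) (volume.prod volume))
    (hut : ∀ n t, Small N t →
      Integrable (nonlocalIntegrand s p u (transport u n t)) (volume.prod volume)) :
    SlopeLE (fun n t => ∫ z, nonlocalIntegrand s p u (transport u n t) z ∂(volume.prod volume))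
      (∫ z, nonlocalIntegrand s p u u z ∂(volume.prod volume))
      (-((N - s * p) / p) * ∫ z, nonlocalIntegrand s p u u z ∂(volume.prod volume)) := by
  have hself : nonlocalIntegrand s p u u
      = fun z => |u z.1 - u z.2| ^ p / ‖z.1 - z.2‖ ^ ((N : ℝ) + s * p) := by
    ext1 z; rw [nonlocalIntegrand, Phi_mul_self hp]
  have he := hu
  rw [hself] at he
  have hd := gagliardo_slope hm he
  have := SlopeLE.of_convex (N := N) (p := p) (g₀ := nonlocalIntegrand s p u u) (by linarith) he
    hd.1 hd.2 hu hut fun n t ht => Eventually.of_forall fun z => by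
      have h1 := Phi_mul_sub_le hp (u z.1 - u z.2) (transport u n t z.1 - transport u n t z.2)
      have h2 : 0 ≤ ‖z.1 - z.2‖ ^ ((N : ℝ) + s * p) := by positivity
      rw [nonlocalIntegrand, nonlocalIntegrand, ← sub_div, ← sub_div, div_right_comm]
      exact div_le_div_of_nonneg_right h1 h2
  refine this.mono (le_of_eq ?_) fun n => Eventually.of_forall fun t => le_rfl
  rw [hself]
  ring

lemma weighted_pairing_slope [NeZero N] {u : E N → ℝ} {p β : ℝ} (hp : 1 < p)
    (hm : AEStronglyMeasurable u volume)
    (hu : Integrable (fun x : E N => ‖x‖ ^ β * Phi p (u x) * u x) volume)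
    (hut : ∀ n t, Small N t →
      Integrable (fun x : E N => ‖x‖ ^ β * Phi p (u x) * transport u n t x) volume) :
    SlopeLE (fun n t => ∫ x : E N, ‖x‖ ^ β * Phi p (u x) * transport u n t x)
      (∫ x : E N, ‖x‖ ^ β * Phi p (u x) * u x)
      (-((N + β) / p) * ∫ x : E N, ‖x‖ ^ β * Phi p (u x) * u x) := by
  have hself : (fun x : E N => ‖x‖ ^ β * Phi p (u x) * u x) = fun x => ‖x‖ ^ β * |u x| ^ p := by
    ext1 x; rw [mul_assoc, Phi_mul_self hp]
  have he := hu
  rw [hself] at he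
  have hd := weighted_slope hm he
  have := SlopeLE.of_convex (N := N) (p := p) (by linarith) he
    hd.1 hd.2.1 hu hut fun n t ht => Eventually.of_forall fun x => by
      have h1 := Phi_mul_sub_le hp (u x) (transport u n t x)
      have h2 : 0 ≤ ‖x‖ ^ β := by positivity
      have h3 := mul_le_mul_of_nonneg_left h1 h2
      calc _ = ‖x‖ ^ β * (Phi p (u x) * transport u n t x - Phi p (u x) * u x) := by ring
        _ ≤ _ := h3
        _ = _ := by rw [transport]; ring
  refine this.mono (le_of_eq ?_) fun n => Eventually.of_forall fun t => le_rfl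
  rw [hself]
  ring

/-- Convexity at u would bound the pairing on the wrong side. Applied at the transported function it
bounds the negated pairing by an energy difference, after `Phi q (u x)` is exchanged for its
transported value; the error of this exchange is `remainder`, whose slope is 0. -/
lemma source_slope [NeZero N] {u : E N → ℝ} {G : E N → E N} {q α M : ℝ} (hq : 1 < q)
    (hw : IsWeakGradient u G) (hM : ∀ᵐ x, |u x| ≤ M)
    (hu : Integrable (fun x : E N => ‖x‖ ^ α * Phi q (u x) * u x) volume)
    (hut : ∀ n t, Small N t →
      Integrable (fun x : E N => ‖x‖ ^ α * Phi q (u x) * transport u n t x) volume) :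
    SlopeLE (fun n t => -∫ x : E N, ‖x‖ ^ α * Phi q (u x) * transport u n t x)
      (-∫ x : E N, ‖x‖ ^ α * Phi q (u x) * u x)
      ((N + α) / q * ∫ x : E N, ‖x‖ ^ α * Phi q (u x) * u x) := by
  have hself : (fun x : E N => ‖x‖ ^ α * Phi q (u x) * u x) = fun x => ‖x‖ ^ α * |u x| ^ q := by
    ext1 x; rw [mul_assoc, Phi_mul_self hq]
  have he := hu
  rw [hself] at he
  have hd := weighted_slope hw.1.aestronglyMeasurable he
  have hrem : SlopeLE (fun n t => ∫ y, remainder n q α u t y) 0 0 := fun ε hε =>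
    Eventually.of_forall fun n => by
      filter_upwards [remainder_isLittleO hw hM hq α n hε] with t ht
      rw [sub_zero, zero_add]
      exact ht.2
  have hsum := (SlopeLE.const_mul (c := 1 / q) (by positivity) fun _ => hd.2.2).add hrem
  refine hsum.mono (le_of_eq (by rw [hself]; ring)) fun n => ?_
  filter_upwards [eventually_small N, remainder_isLittleO hw hM hq α n one_pos] with t ht hr
  have hpt : ∀ x : E N, -(‖x‖ ^ α * Phi q (u x) * transport u n t x)
      - -(‖x‖ ^ α * Phi q (u x) * u x)
      ≤ -(‖x‖ ^ α * |transport u n t x| ^ q - ‖x‖ ^ α * |u x| ^ q) / q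
        + remainder n q α u t x := by
    intro x
    have h0 : 0 ≤ ‖x‖ ^ α := by positivity
    -- The roles are reversed: the base point of the convexity inequality is the transported value.
    have h1 := Phi_mul_sub_le hq (transport u n t x) (u x)
    have h2 : (Phi q (transport u n t x) - Phi q (u x)) * (transport u n t x - u x)
        ≤ |Phi q (transport u n t x) - Phi q (u x)| * |transport u n t x - u x| := by
      rw [← abs_mul]; exact le_abs_self _
    have h3 : -(Phi q (u x) * (transport u n t x - u x))
        ≤ (|u x| ^ q - |transport u n t x| ^ q) / q
          + |Phi q (transport u n t x) - Phi q (u x)| * |transport u n t x - u x| := by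
      linarith
    have h4 := mul_le_mul_of_nonneg_left h3 h0
    calc _ = ‖x‖ ^ α * -(Phi q (u x) * (transport u n t x - u x)) := by ring
      _ ≤ _ := h4
      _ = _ := by rw [remainder, transport]; ring
  have ht' : Integrable (fun x : E N => ‖x‖ ^ α * |transport u n t x| ^ q) volume := hd.1 n t ht
  have i1 : Integrable (fun x : E N => -(‖x‖ ^ α * Phi q (u x) * transport u n t x)) volume :=
    (hut n t ht).neg
  have i2 : Integrable (fun x : E N => -(‖x‖ ^ α * Phi q (u x) * u x)) volume := hu.neg
  have i3 : Integrable (fun x : E N =>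
      -(‖x‖ ^ α * |transport u n t x| ^ q - ‖x‖ ^ α * |u x| ^ q) / q) volume :=
    (ht'.sub he).neg.div_const q
  have h := integral_mono_ae (i1.sub i2) (i3.add hr.1) (Eventually.of_forall hpt)
  simp only [Pi.sub_apply, Pi.add_apply] at h
  rw [integral_add i3 hr.1, integral_sub i1 i2, integral_div, integral_neg, integral_neg,
    integral_neg, integral_sub ht' he] at h
  refine h.trans (le_of_eq ?_)
  simp only [transport]
  ring

end Deformed

/-! ### The Pohozaev inequality and nonexistence -/

section Operator

variable {N : ℕ}

/-- The order `σ` of the space `𝒲`: `s` if `γ = 0` and `1` otherwise. -/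
def spaceOrder (γ s : ℝ) : ℝ := if γ = 0 then s else 1

lemma fracPairing_self_nonneg {s p : ℝ} (hp : 1 < p) (u : E N → ℝ) : 0 ≤ fracPairing s p u u := by
  unfold fracPairing
  split_ifs
  · refine integral_nonneg fun x => ?_
    rw [localIntegrand, inner_PhiVec_self hp]
    positivity
  · refine integral_nonneg fun z => ?_
    rw [nonlocalIntegrand, Phi_mul_self hp]
    positivity

/-- The slope of `t ↦ ⟨ℒ u, u ∘ φ_t⁻¹⟩`. -/
lemma opPairing_slope [NeZero N] {u : E N → ℝ} {γ s p β : ℝ} (hγ0 : 0 ≤ γ) (hγ1 : γ ≤ 1)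
    (hs1 : s ≤ 1) (hp : 1 < p) (hu : MemCalW γ s p β u) (hc : OpPairingConverges γ s p u u)
    (hct : ∀ n t, Small N t → OpPairingConverges γ s p u (transport u n t)) :
    SlopeLE (fun n t => opPairing γ s p u (transport u n t)) (opPairing γ s p u u)
      (-((N - spaceOrder γ s * p) / p) * opPairing γ s p u u) := by
  obtain ⟨⟨⟨hm, -⟩, hf⟩, -⟩ := hu
  have hσ : s ≤ spaceOrder γ s := by
    unfold spaceOrder; split_ifs
    · exact le_rfl
    · exact hs1
  have hloc : γ ≠ 0 → SlopeLE (fun n t => ∫ x, localIntegrand p u (transport u n t) x)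
      (∫ x, localIntegrand p u u x)
      (-((N - spaceOrder γ s * p) / p) * ∫ x, localIntegrand p u u x) := by
    intro hγ
    rw [if_neg hγ, FiniteSeminorm, if_pos rfl] at hf
    have := local_slope hp hf.1 hf.2 fun n t ht => (hct n t ht).1 hγ
    rwa [spaceOrder, if_neg hγ, one_mul]
  have hfrac : 1 - γ ≠ 0 → SlopeLE (fun n t => fracPairing s p u (transport u n t))
      (fracPairing s p u u) (-((N - spaceOrder γ s * p) / p) * fracPairing s p u u) := by
    intro h
    have hγ : γ ≠ 1 := fun h1 => h (by rw [h1, sub_self])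
    have hnn := fracPairing_self_nonneg (s := s) hp u
    have hcu := hc.2 hγ
    have hcut := fun n t ht => (hct n t ht).2 hγ
    unfold FracPairingConverges at hcu hcut
    unfold fracPairing at hnn ⊢
    split_ifs at hnn hcu hcut ⊢ with hs
    · have hσ1 : spaceOrder γ s = 1 := by unfold spaceOrder; split_ifs <;> simp [hs]
      have hf' : FiniteSeminorm 1 p u := by
        split_ifs at hf
        · rwa [hs] at hf
        · exact hf
      rw [FiniteSeminorm, if_pos rfl] at hf'
      rw [hσ1, one_mul]
      exact local_slope hp hf'.1 hf'.2 hcut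
    -- The nonlocal term has the slope coefficient -(N - sp)/p, at most -(N - σp)/p since s ≤ σ. As
    -- the pairing is nonnegative, the slope bound may be relaxed, so that both parts of the
    -- operator share one coefficient.
    · refine (nonlocal_slope hp hm hcu hcut).mono ?_ fun n => Eventually.of_forall fun t => le_rfl
      refine mul_le_mul_of_nonneg_right ?_ hnn
      have hp0 : 0 < p := by linarith
      rw [neg_le_neg_iff]
      gcongr
  unfold opPairing
  refine ((SlopeLE.const_mul hγ0 hloc).add
    (SlopeLE.const_mul (sub_nonneg.2 hγ1) hfrac)).mono (le_of_eq (by ring))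
    fun n => Eventually.of_forall fun t => le_rfl

/-- The Pohozaev inequality for bounded weak solutions with a weak gradient. -/
theorem pohozaev_inequality [NeZero N] {u : E N → ℝ} {γ s p q α β : ℝ} (hγ0 : 0 ≤ γ)
    (hγ1 : γ ≤ 1) (hs1 : s ≤ 1) (hp : 1 < p) (hq : 1 < q) (hb : MemLp u ∞ volume)
    (hw : HasWeakGradient u) (hu : IsWeakSolution γ s p q α β u) :
    (N - spaceOrder γ s * p) / p * opPairing γ s p u u
        + (N + β) / p * ∫ x : E N, ‖x‖ ^ β * Phi p (u x) * u x
      ≤ (N + α) / q * ∫ x : E N, ‖x‖ ^ α * Phi q (u x) * u x := by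
  obtain ⟨hmem, hsol⟩ := hu
  have hself := hsol u hmem
  have htr := fun n t (ht : Small N t) => hsol _ (memCalW_transport (n := n) hp hmem ht)
  obtain ⟨M, hM⟩ : ∃ M, ∀ᵐ x, |u x| ≤ M := by
    refine ⟨(eLpNorm u ∞ volume).toReal, ?_⟩
    rw [eLpNorm_exponent_top]
    filter_upwards [ae_le_eLpNormEssSup (f := u) (μ := volume)] with x hx
    rw [← Real.norm_eq_abs, ← toReal_enorm]
    refine ENNReal.toReal_mono ?_ hx
    rw [← eLpNorm_exponent_top]
    exact hb.eLpNorm_ne_top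
  have h1 := opPairing_slope hγ0 hγ1 hs1 hp hmem hself.1 fun n t ht => (htr n t ht).1
  have h2 := weighted_pairing_slope hp hmem.1.1.1 hself.2.1 fun n t ht => (htr n t ht).2.1
  have h3 := source_slope hq hw.isWeakGradient hM hself.2.2.1 fun n t ht => (htr n t ht).2.2.1
  -- By the weak formulation the three terms sum to zero for the test function `u_t` and for `u`
  -- alike.
  have := ((h1.add h2).add h3).nonneg fun n => by
    filter_upwards [eventually_small N] with t ht
    rw [(htr n t ht).2.2.2, hself.2.2.2, add_neg_cancel, add_neg_cancel]
  linarith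

/-- Supercritical problems have no nontrivial bounded weak solution with a weak gradient. -/
theorem ae_eq_zero_of_isWeakSolution {u : E N → ℝ} {γ s p q α β : ℝ}
    (hγ0 : 0 ≤ γ) (hγ1 : γ ≤ 1) (hs0 : 0 < s) (hs1 : s ≤ 1) (hp : 1 < p)
    (hsN : s < (N : ℝ) / p) (hpN : 0 < γ → p < (N : ℝ)) (hα : -(s * p) < α)
    (hβ : p * (1 - s) < β) (hq : critExp N γ s p α < q) (hb : MemLp u ∞ volume)
    (hw : HasWeakGradient u) (hsol : IsWeakSolution γ s p q α β u) : u =ᵐ[volume] 0 := by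
  have hp0 : 0 < p := by linarith
  have hspN : s * p < N := by rwa [lt_div_iff₀ hp0] at hsN
  have hN0 : N ≠ 0 := by
    rintro rfl
    have : 0 < s * p := by positivity
    simp only [Nat.cast_zero] at hspN
    linarith
  have : NeZero N := ⟨hN0⟩
  set σ := spaceOrder γ s with hσ
  have hsσ : s * p ≤ σ * p := by
    rw [hσ]; unfold spaceOrder; split_ifs
    · exact le_rfl
    · gcongr
  have hσN : σ * p < N := by
    rw [hσ]; unfold spaceOrder; split_ifs with h
    · exact hspN
    · rw [one_mul]; exact hpN (lt_of_le_of_ne hγ0 (Ne.symm h))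
  have hcrit : p * (N + α) / (N - σ * p) < q := by
    rw [hσ]; unfold critExp at hq; unfold spaceOrder
    split_ifs at hq ⊢
    · exact hq
    · rwa [one_mul]
  have hd : 0 < N - σ * p := by linarith
  -- From α > -sp ≥ -σp, the critical exponent is at least p.
  have hpq : p < q := by
    refine lt_of_le_of_lt ?_ hcrit
    rw [le_div_iff₀ hd]
    gcongr
    linarith
  have hq1 : 1 < q := hp.trans hpq
  have hpoh := pohozaev_inequality hγ0 hγ1 hs1 hp hq1 hb hw hsol
  obtain ⟨-, -, hint, heq⟩ := hsol.2 u hsol.1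
  have hself : (fun x : E N => ‖x‖ ^ α * Phi q (u x) * u x) = fun x => ‖x‖ ^ α * |u x| ^ q := by
    ext1 x; rw [mul_assoc, Phi_mul_self hq1]
  have hB0 : 0 ≤ ∫ x : E N, ‖x‖ ^ β * Phi p (u x) * u x :=
    integral_nonneg fun x => by
      simp only
      rw [mul_assoc, Phi_mul_self hp]
      positivity
  have hA0 : 0 ≤ ∫ x : E N, ‖x‖ ^ α * |u x| ^ q := integral_nonneg fun x => by positivity
  rw [hself] at hint hpoh heq
  set A := ∫ x : E N, ‖x‖ ^ α * |u x| ^ q with hA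
  set B := ∫ x : E N, ‖x‖ ^ β * Phi p (u x) * u x with hB
  have hβ0 : 0 ≤ β := (mul_nonneg hp0.le (sub_nonneg.2 hs1)).trans hβ.le
  -- Lowering the coefficient of B to that of the operator term lets the two combine, through the
  -- equation tested with u, into a multiple of A.
  have hτβ : (N - σ * p) / p * B ≤ (N + β) / p * B := by
    have : 0 ≤ σ * p := le_trans (by positivity) hsσ
    gcongr
    linarith
  have hτ : (N + α) / q < (N - σ * p) / p := by
    rw [div_lt_iff₀ hd] at hcrit
    rw [div_lt_div_iff₀ (by linarith) hp0]
    linarith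
  have hAz : A = 0 := by
    refine le_antisymm ?_ hA0
    have h1 : (N - σ * p) / p * A ≤ (N + α) / q * A := by
      have e : (N - σ * p) / p * A = (N - σ * p) / p * opPairing γ s p u u
          + (N - σ * p) / p * B := by rw [← heq]; ring
      linarith
    nlinarith
  rw [hA, integral_eq_zero_iff_of_nonneg (fun x => by positivity) hint] at hAz
  filter_upwards [hAz, Measure.ae_ne volume (0 : E N)] with x hx hx0
  have h1 : ‖x‖ ^ α ≠ 0 := (Real.rpow_pos_of_pos (norm_pos_iff.2 hx0) α).ne'
  have h2 : |u x| ^ q = 0 := (mul_eq_zero.1 hx).resolve_left h1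
  simpa using ((Real.rpow_eq_zero_iff_of_nonneg (abs_nonneg _)).1 h2).1

end Operator

end

end MixedHenon

/-- Every weak solution in the class `MemX`, of whatever sign, vanishes almost everywhere; in
particular there is no positive one. In the presence of the local term (`γ > 0`) the critical
exponent is `p (N + α) / (N - p)`, so `p < N` is required there. -/
theorem theorem1p3 (N : ℕ) (γ s p q α β : ℝ)
    (hγ0 : 0 ≤ γ) (hγ1 : γ ≤ 1) (hs0 : 0 < s) (hs1 : s ≤ 1) (hp : 1 < p)
    (hps : 1 / p < s) (hsN : s < (N : ℝ) / p) (hpN : 0 < γ → p < (N : ℝ))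
    (hα : -(s * p) < α) (hβ : p * (1 - s) < β)
    (hq : MixedHenon.critExp N γ s p α < q) :
    ∀ u : MixedHenon.E N → ℝ, MixedHenon.MemX γ s p β u →
      MixedHenon.IsWeakSolution γ s p q α β u → u =ᵐ[volume] 0 := by
  exact fun u hX hsol => MixedHenon.ae_eq_zero_of_isWeakSolution hγ0 hγ1 hs0 hs1 hp hsN hpN hα hβ hq
    hX.2.1 hX.2.2.1 hsol
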